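/- Let $\mathbb K$ be a field of characteristic $0$. A differential graded Lie algebra (DGLA) is a $\mathbb Z$-graded $\mathbb K$-vector space $L=\bigoplus_i L^i$ with a graded skew-symmetric bilinear bracket satisfying the graded Jacobi identity and a differential $d$ of degree $1$, $d^2=0$, which is a derivation of the bracket. Let $\mathbf{Art}_{\mathbb K}$ be the category of local Artinian $\mathbb K$-algebras $A$ with residue field $\mathbb K$ and maximal ideal $\mathfrak m_A$, with local homomorphisms of $\mathbb K$-algebras as morphisms. The deformation functor $\mathrm{Def}_L\colon\mathbf{Art}_{\mathbb K}\to\mathbf{Set}$ sends $A$ to the set of Maurer–Cartan elements $$\{x\in L^1\otimes\mathfrak m_A \mid dx+\tfrac12[x,x]=0\}$$ modulo the gauge action of the group $\exp(L^0\otimes\mathfrak m_A)$, given by $$\exp(a)(x)=x+\sum_{n\ge0}\frac{\mathrm{ad}(a)^n}{(n+1)!}([a,x]-da).$$ A natural transformation $\eta\colon F\to G$ of functors $\mathbf{Art}_{\mathbb K}\to\mathbf{Set}$ is smooth if for every surjection $p\colon B\to A$ in $\mathbf{Art}_{\mathbb K}$ with $\mathfrak m_B\ker p=0$ the map $F(B)\to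 G(B)\times_{G(A)}F(A)$ is surjective. Let $\phi\colon L\to N$ be a morphism of DGLAs over $\mathbb K$, with induced maps $H^i(\phi)\colon H^i(L)\to H^i(N)$ in cohomology and $\mathrm{Def}_\phi\colon\mathrm{Def}_L\to\mathrm{Def}_N$. 1. If $H^1(\phi)$ is surjective and $H^2(\phi)$ is injective, then $\mathrm{Def}_\phi$ is smooth. 2. If $H^0(\phi)$ is surjective, $H^1(\phi)$ is bijective and $H^2(\phi)$ is injective, then $\mathrm{Def}_\phi$ is an isomorphism of functors. 3. If $\phi$ is a quasi-isomorphism (all $H^i(\phi)$, $i\in\mathbb Z$, are bijective), then $\mathrm{Def}_\phi$ is an isomorphism of functors. Consequently, if two DGLAs $L$ and $N$ are quasi-isomorphic (equivalent under the equivalence relation generated by quasi-isomorphisms), then $\mathrm{Def}_L$ and $\mathrm{Def}_N$ are isomorphic functors. -/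

import Mathlib

open CategoryTheory TensorProduct

universe u v

/-- A differential graded Lie algebra over `K`: a `ℤ`-graded vector space `L = ⨁ Lⁱ` with a
bilinear bracket and a differential of degree `1`. -/
structure DGLA (K : Type u) [Field K] where
  /-- the underlying vector space `L` -/
  carrier : Type v
  [addCommGroup : AddCommGroup carrier]
  [module : Module K carrier]
  /-- the homogeneous component `Lⁱ` -/
  grading : ℤ → Submodule K carrier
  isInternal : DirectSum.IsInternal grading
  bracket : carrier →ₗ[K] carrier →ₗ[K] carrier
  d : carrier →ₗ[K] carrier
  bracket_mem : ∀ {i j : ℤ} {a b : carrier}, a ∈ grading i → b ∈ grading j →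
    bracket a b ∈ grading (i + j)
  bracket_skew : ∀ {i j : ℤ} {a b : carrier}, a ∈ grading i → b ∈ grading j →
    bracket a b + (-1 : K) ^ (i * j) • bracket b a = 0
  jacobi : ∀ {i j k : ℤ} {a b c : carrier}, a ∈ grading i → b ∈ grading j → c ∈ grading k →
    bracket a (bracket b c) =
      bracket (bracket a b) c + (-1 : K) ^ (i * j) • bracket b (bracket a c)
  d_mem : ∀ {i : ℤ} {a : carrier}, a ∈ grading i → d a ∈ grading (i + 1)
  d_d : ∀ a : carrier, d (d a) = 0
  d_bracket : ∀ {i j : ℤ} {a b : carrier}, a ∈ grading i → b ∈ grading j →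
    d (bracket a b) = bracket (d a) b + (-1 : K) ^ i • bracket a (d b)

attribute [instance] DGLA.addCommGroup DGLA.module

namespace DGLA

variable {K : Type u} [Field K]

/-- Morphisms of differential graded Lie algebras. -/
structure Hom (L N : DGLA.{u, v} K) where
  toLinearMap : L.carrier →ₗ[K] N.carrier
  map_mem : ∀ {i : ℤ} {a : L.carrier}, a ∈ L.grading i → toLinearMap a ∈ N.grading i
  map_bracket : ∀ a b : L.carrier,
    toLinearMap (L.bracket a b) = N.bracket (toLinearMap a) (toLinearMap b)
  map_d : ∀ a : L.carrier, toLinearMap (L.d a) = N.d (toLinearMap a)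

section Cohomology

variable (L N : DGLA.{u, v} K)

/-- The cocycles `Zⁱ(L) = ker (d : Lⁱ → Lⁱ⁺¹)`. -/
def cocycles (i : ℤ) : Submodule K L.carrier := L.grading i ⊓ LinearMap.ker L.d

/-- The coboundaries `Bⁱ(L) = im (d : Lⁱ⁻¹ → Lⁱ)`. -/
def coboundaries (i : ℤ) : Submodule K L.carrier := (L.grading (i - 1)).map L.d

/-- The cohomology `Hⁱ(L) = Zⁱ(L) / Bⁱ(L)`. -/
abbrev cohomology (i : ℤ) : Type v :=
  L.cocycles i ⧸ (L.coboundaries i).submoduleOf (L.cocycles i)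

variable {L N}

/-- The map `Zⁱ(L) → Zⁱ(N)` induced by a morphism. -/
def Hom.cocyclesMap (φ : L.Hom N) (i : ℤ) : L.cocycles i →ₗ[K] N.cocycles i :=
  φ.toLinearMap.restrict fun x hx =>
    ⟨φ.map_mem hx.1, by
      have h : L.d x = 0 := hx.2
      exact LinearMap.mem_ker.mpr (by rw [← φ.map_d, h, map_zero])⟩

/-- The map `Hⁱ(φ) : Hⁱ(L) → Hⁱ(N)` induced by a morphism. -/
def Hom.cohomologyMap (φ : L.Hom N) (i : ℤ) : L.cohomology i →ₗ[K] N.cohomology i :=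
  Submodule.mapQ _ _ (φ.cocyclesMap i) (by
    rintro ⟨x, hx⟩ ⟨y, hy, hyx⟩
    exact ⟨φ.toLinearMap y, φ.map_mem hy, by
      rw [← φ.map_d, hyx]; rfl⟩)

/-- A quasi-isomorphism is a morphism inducing isomorphisms in cohomology. -/
def Hom.IsQuasiIso (φ : L.Hom N) : Prop :=
  ∀ i : ℤ, Function.Bijective (φ.cohomologyMap i)

/-- Two DGLAs are quasi-isomorphic if they are equivalent under the equivalence relation
generated by quasi-isomorphisms. -/
def QuasiIsomorphic (L N : DGLA.{u, v} K) : Prop :=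
  Relation.EqvGen (fun L N : DGLA.{u, v} K => ∃ φ : L.Hom N, φ.IsQuasiIso) L N

end Cohomology

section MaurerCartan

variable (L N : DGLA.{u, v} K)

/-- The Maurer-Cartan elements: `x ∈ L¹` with `dx + ½[x,x] = 0`. -/
def MaurerCartan : Set L.carrier :=
  {x | x ∈ L.grading 1 ∧ L.d x + (2 : K)⁻¹ • L.bracket x x = 0}

/-- The gauge transformation `exp(a)(w) = w + ∑ₙ ad(a)ⁿ([a,w] - da) / (n+1)!`. The sum is finite
as soon as `ad(a)` is nilpotent, which is the only case in which it is used. -/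
noncomputable def gauge (a w : L.carrier) : L.carrier :=
  w + ∑ᶠ n : ℕ, ((n + 1).factorial : K)⁻¹ •
    ((L.bracket a : Module.End K L.carrier) ^ n) (L.bracket a w - L.d a)

/-- `x` is moved to `y` by some gauge transformation `exp(a)`, `a ∈ L⁰`. -/
def GaugeRel (x y : L.MaurerCartan) : Prop :=
  ∃ a ∈ L.grading 0, y.1 = L.gauge a x.1

/-- The set of orbits of the gauge action of the group `exp(L⁰)` on Maurer-Cartan elements. (Every
element of that group is `exp(a)` for some `a ∈ L⁰`, so the orbits are the classes of
`GaugeRel`.) -/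
def GaugeOrbits : Type v := Quot L.GaugeRel

variable {L N}

/-- A morphism of DGLAs preserves Maurer-Cartan elements. -/
def Hom.maurerCartanMap (φ : L.Hom N) (x : L.MaurerCartan) : N.MaurerCartan :=
  ⟨φ.toLinearMap x.1, φ.map_mem x.2.1, by
    rw [← φ.map_d, ← φ.map_bracket, ← map_smul, ← map_add, x.2.2, map_zero]⟩

variable (L) in
/-- For every `a ∈ L⁰` the operator `ad(a)` is nilpotent. -/
def AdNilpotent : Prop :=
  ∀ a ∈ L.grading 0, IsNilpotent (L.bracket a : Module.End K L.carrier)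

theorem Hom.map_ad_pow (φ : L.Hom N) (a x : L.carrier) (n : ℕ) :
    φ.toLinearMap (((L.bracket a : Module.End K L.carrier) ^ n) x) =
      ((N.bracket (φ.toLinearMap a) : Module.End K N.carrier) ^ n) (φ.toLinearMap x) := by
  induction n generalizing x with
  | zero => rfl
  | succ n ih => rw [pow_succ, pow_succ, Module.End.mul_apply, Module.End.mul_apply, ih,
      φ.map_bracket]

theorem gauge_support_finite {a : L.carrier}
    (ha : IsNilpotent (L.bracket a : Module.End K L.carrier)) (x : L.carrier) :
    (Function.support fun n : ℕ => ((n + 1).factorial : K)⁻¹ •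
      ((L.bracket a : Module.End K L.carrier) ^ n) x).Finite := by
  obtain ⟨m, hm⟩ := ha
  refine (Set.finite_lt_nat m).subset fun n hn => ?_
  by_contra h
  refine hn ?_
  simp only [pow_eq_zero_of_le (not_lt.mp h) hm, LinearMap.zero_apply, smul_zero]

theorem Hom.map_gauge (φ : L.Hom N) {a : L.carrier}
    (ha : IsNilpotent (L.bracket a : Module.End K L.carrier)) (w : L.carrier) :
    φ.toLinearMap (L.gauge a w) = N.gauge (φ.toLinearMap a) (φ.toLinearMap w) := by
  unfold gauge
  have h := φ.toLinearMap.toAddMonoidHom.map_finsum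
    (gauge_support_finite ha (L.bracket a w - L.d a))
  simp only [LinearMap.toAddMonoidHom_coe] at h
  rw [map_add, h]
  simp only [map_smul, φ.map_ad_pow, map_sub, φ.map_bracket, φ.map_d]

/-- The map on gauge orbits induced by a morphism of DGLAs. -/
def Hom.gaugeOrbitsMap (φ : L.Hom N) (hL : L.AdNilpotent) : L.GaugeOrbits → N.GaugeOrbits :=
  Quot.map φ.maurerCartanMap (by
    rintro x y ⟨a, ha, h⟩
    refine ⟨φ.toLinearMap a, φ.map_mem ha, ?_⟩
    change φ.toLinearMap y.1 = N.gauge (φ.toLinearMap a) (φ.toLinearMap x.1)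
    rw [h, φ.map_gauge (hL a ha)])

theorem Hom.gaugeOrbitsMap_comp {L M N : DGLA.{u, v} K} (φ : L.Hom M) (ψ : M.Hom N) (χ : L.Hom N)
    (hL : L.AdNilpotent) (hM : M.AdNilpotent)
    (h : ∀ x, χ.toLinearMap x = ψ.toLinearMap (φ.toLinearMap x)) (q : L.GaugeOrbits) :
    χ.gaugeOrbitsMap hL q = ψ.gaugeOrbitsMap hM (φ.gaugeOrbitsMap hL q) := by
  obtain ⟨x⟩ := q
  exact congrArg (Quot.mk _) (Subtype.ext (h x.1))

end MaurerCartan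

end DGLA

/-- Local Artinian `K`-algebras with residue field `K`. -/
structure ArtAlg (K : Type u) [Field K] where
  carrier : Type u
  [commRing : CommRing carrier]
  [algebra : Algebra K carrier]
  [isLocalRing : IsLocalRing carrier]
  [isArtinianRing : IsArtinianRing carrier]
  residue_bijective : Function.Bijective (algebraMap K (IsLocalRing.ResidueField carrier))

attribute [instance] ArtAlg.commRing ArtAlg.algebra ArtAlg.isLocalRing ArtAlg.isArtinianRing

namespace ArtAlg

variable {K : Type u} [Field K]

/-- Morphisms of `ArtAlg K` are the local homomorphisms of `K`-algebras. -/
@[ext]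
structure Hom (A B : ArtAlg K) where
  toAlgHom : A.carrier →ₐ[K] B.carrier
  isLocalHom : IsLocalHom (toAlgHom : A.carrier →+* B.carrier)

instance : Category (ArtAlg K) where
  Hom A B := Hom A B
  id A := ⟨AlgHom.id K A.carrier, ⟨fun _ h => h⟩⟩
  comp f g := ⟨g.toAlgHom.comp f.toAlgHom,
    ⟨fun a h => f.isLocalHom.map_nonunit a (g.isLocalHom.map_nonunit _ h)⟩⟩

/-- The maximal ideal of `A`. -/
abbrev maxIdeal (A : ArtAlg K) : Ideal A.carrier := IsLocalRing.maximalIdeal A.carrier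

/-- The multiplication of the maximal ideal. -/
def mulMax (A : ArtAlg K) : A.maxIdeal →ₗ[K] A.maxIdeal →ₗ[K] A.maxIdeal :=
  LinearMap.mk₂ K (fun x y => ⟨x.1 * y.1, A.maxIdeal.mul_mem_left _ y.2⟩)
    (fun _ _ _ => Subtype.ext (add_mul _ _ _))
    (fun _ _ _ => Subtype.ext (smul_mul_assoc _ _ _))
    (fun _ _ _ => Subtype.ext (mul_add _ _ _))
    (fun _ _ _ => Subtype.ext (mul_smul_comm _ _ _))

@[simp]
theorem coe_mulMax (A : ArtAlg K) (x y : A.maxIdeal) :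
    (A.mulMax x y : A.carrier) = (x : A.carrier) * (y : A.carrier) := rfl

theorem mulMax_comm (A : ArtAlg K) (x y : A.maxIdeal) : A.mulMax x y = A.mulMax y x :=
  Subtype.ext (mul_comm _ _)

theorem mulMax_assoc (A : ArtAlg K) (x y z : A.maxIdeal) :
    A.mulMax (A.mulMax x y) z = A.mulMax x (A.mulMax y z) :=
  Subtype.ext (mul_assoc _ _ _)

/-- The map of maximal ideals induced by a morphism. -/
def Hom.maxMap {A B : ArtAlg K} (f : A ⟶ B) : A.maxIdeal →ₗ[K] B.maxIdeal where
  toFun x := ⟨f.toAlgHom x.1, by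
    have h : ¬ IsUnit x.1 := (IsLocalRing.mem_maximalIdeal _).mp x.2
    exact (IsLocalRing.mem_maximalIdeal _).mpr fun h' => h (f.isLocalHom.map_nonunit _ h')⟩
  map_add' _ _ := Subtype.ext (map_add _ _ _)
  map_smul' _ _ := Subtype.ext (map_smul _ _ _)

/-- A small extension: a surjection `p : B → A` whose kernel is annihilated by the maximal ideal
of `B`. -/
def IsSmallExtension {A B : ArtAlg K} (p : B ⟶ A) : Prop :=
  Function.Surjective p.toAlgHom ∧
    ∀ b ∈ B.maxIdeal, ∀ x : B.carrier, p.toAlgHom x = 0 → b * x = 0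

/-- A natural transformation `η : F → G` is smooth if for every small extension `p : B → A` the map
`(η, p) : F(B) → G(B) ×_{G(A)} F(A)` is surjective. -/
def IsSmooth {F G : ArtAlg K ⥤ Type v} (η : F ⟶ G) : Prop :=
  ∀ ⦃A B : ArtAlg K⦄ (p : B ⟶ A), IsSmallExtension p →
    ∀ (y : G.obj B) (x : F.obj A), G.map p y = η.app A x →
      ∃ z : F.obj B, η.app B z = y ∧ F.map p z = x

end ArtAlg

namespace DGLA

variable {K : Type u} [Field K]

open ArtAlg

theorem grading_tensor_induction {L : DGLA.{u, v} K} {V : Type u} [AddCommGroup V] [Module K V]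
    {i : ℤ} {p : L.carrier ⊗[K] V → Prop} (zero : p 0)
    (tmul : ∀ x ∈ L.grading i, ∀ r : V, p (x ⊗ₜ r)) (add : ∀ x y, p x → p y → p (x + y))
    {x : L.carrier ⊗[K] V} (hx : x ∈ DirectSum.decomposeTensor L.grading V i) : p x := by
  obtain ⟨y, rfl⟩ := hx
  induction y with
  | zero => rw [map_zero]; exact zero
  | tmul x r => exact tmul x.1 x.2 r
  | add x y hx hy => rw [map_add]; exact add _ _ hx hy

theorem tmul_mem_grading {L : DGLA.{u, v} K} {V : Type u} [AddCommGroup V] [Module K V]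
    {i : ℤ} {x : L.carrier} (hx : x ∈ L.grading i) (r : V) :
    x ⊗ₜ[K] r ∈ DirectSum.decomposeTensor L.grading V i :=
  ⟨(⟨x, hx⟩ : L.grading i) ⊗ₜ r, rfl⟩

/-- The bracket `[x ⊗ r, y ⊗ s] = [x,y] ⊗ rs` on `L ⊗ 𝔪_A`. -/
noncomputable def tensorBracket (L : DGLA.{u, v} K) (A : ArtAlg K) :
    L.carrier ⊗[K] A.maxIdeal →ₗ[K] L.carrier ⊗[K] A.maxIdeal →ₗ[K] L.carrier ⊗[K] A.maxIdeal :=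
  TensorProduct.map₂ L.bracket A.mulMax

@[simp]
theorem tensorBracket_tmul (L : DGLA.{u, v} K) (A : ArtAlg K) (x y : L.carrier)
    (r s : A.maxIdeal) :
    L.tensorBracket A (x ⊗ₜ r) (y ⊗ₜ s) = L.bracket x y ⊗ₜ A.mulMax r s := rfl

/-- The DGLA `L ⊗ 𝔪_A`, with `(L ⊗ 𝔪_A)ⁱ = Lⁱ ⊗ 𝔪_A`, `d(x ⊗ r) = dx ⊗ r` and
`[x ⊗ r, y ⊗ s] = [x,y] ⊗ rs`. -/
@[reducible]
noncomputable def tensor (L : DGLA.{u, v} K) (A : ArtAlg K) : DGLA.{u, max u v} K where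
  carrier := L.carrier ⊗[K] A.maxIdeal
  grading := DirectSum.decomposeTensor L.grading A.maxIdeal
  isInternal :=
    letI := L.isInternal.chooseDecomposition
    letI := DirectSum.tensorDecomposition L.grading A.maxIdeal
    DirectSum.Decomposition.isInternal _
  bracket := L.tensorBracket A
  d := L.d.rTensor A.maxIdeal
  bracket_mem {i j a b} ha hb := by
    refine grading_tensor_induction (p := fun a => L.tensorBracket A a b ∈ (DirectSum.decomposeTensor L.grading A.maxIdeal (i + j))) ?_ (fun x hx r => ?_) (fun x y hx hy => ?_) ha
    · simp
    · refine grading_tensor_induction (p := fun b => L.tensorBracket A (x ⊗ₜ r) b ∈ (DirectSum.decomposeTensor L.grading A.maxIdeal (i + j))) ?_ (fun y hy s => ?_) (fun y z hy hz => ?_) hb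
      · simp
      · exact tmul_mem_grading (L.bracket_mem hx hy) _
      · rw [map_add]; exact add_mem hy hz
    · rw [map_add]; exact add_mem hx hy
  bracket_skew {i j a b} ha hb := by
    refine grading_tensor_induction (p := fun a => L.tensorBracket A a b + (-1 : K) ^ (i * j) • L.tensorBracket A b a = 0) ?_ (fun x hx r => ?_) (fun x y hx hy => ?_) ha
    · simp
    · refine grading_tensor_induction (p := fun b => L.tensorBracket A (x ⊗ₜ r) b + (-1 : K) ^ (i * j) • L.tensorBracket A b (x ⊗ₜ r) = 0) ?_ (fun y hy s => ?_) (fun y z hy hz => ?_) hb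
      · simp
      · rw [tensorBracket_tmul, tensorBracket_tmul, A.mulMax_comm s r,
          TensorProduct.smul_tmul', ← TensorProduct.add_tmul, L.bracket_skew hx hy,
          TensorProduct.zero_tmul]
      · rw [map_add, map_add, LinearMap.add_apply, smul_add, add_add_add_comm, hy, hz, add_zero]
    · rw [map_add, map_add, LinearMap.add_apply, smul_add, add_add_add_comm, hx, hy, add_zero]
  jacobi {i j k a b c} ha hb hc := by
    refine grading_tensor_induction (p := fun a => L.tensorBracket A a (L.tensorBracket A b c) =
      L.tensorBracket A (L.tensorBracket A a b) c + (-1 : K) ^ (i * j) • L.tensorBracket A b (L.tensorBracket A a c)) ?_ (fun x hx r => ?_) (fun x y hx hy => ?_) ha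
    · simp
    · refine grading_tensor_induction (p := fun b => L.tensorBracket A (x ⊗ₜ r) (L.tensorBracket A b c) =
      L.tensorBracket A (L.tensorBracket A (x ⊗ₜ r) b) c + (-1 : K) ^ (i * j) • L.tensorBracket A b (L.tensorBracket A (x ⊗ₜ r) c)) ?_ (fun y hy s => ?_) (fun y z hy hz => ?_) hb
      · simp
      · refine grading_tensor_induction (p := fun c => L.tensorBracket A (x ⊗ₜ r) (L.tensorBracket A (y ⊗ₜ s) c) =
      L.tensorBracket A (L.tensorBracket A (x ⊗ₜ r) (y ⊗ₜ s)) c + (-1 : K) ^ (i * j) • L.tensorBracket A (y ⊗ₜ s) (L.tensorBracket A (x ⊗ₜ r) c)) ?_ (fun z hz t => ?_) (fun z w hz hw => ?_) hc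
        · simp
        · simp only [tensorBracket_tmul]
          rw [← A.mulMax_assoc s r t, A.mulMax_comm s r, A.mulMax_assoc r s t,
            TensorProduct.smul_tmul', ← TensorProduct.add_tmul, L.jacobi hx hy hz]
        · simp only [map_add, smul_add, hz, hw]; abel
      · simp only [map_add, LinearMap.add_apply, smul_add, hy, hz]; abel
    · simp only [map_add, LinearMap.add_apply, smul_add, hx, hy]; abel
  d_mem {i a} ha := by
    refine grading_tensor_induction (p := fun a => L.d.rTensor A.maxIdeal a ∈
      DirectSum.decomposeTensor L.grading A.maxIdeal (i + 1)) ?_ (fun x hx r => ?_) (fun x y hx hy => ?_) ha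
    · simp
    · exact tmul_mem_grading (L.d_mem hx) _
    · rw [map_add]; exact add_mem hx hy
  d_d a := by
    induction a with
    | zero => simp
    | tmul x r => simp [L.d_d]
    | add x y hx hy => simp [hx, hy]
  d_bracket {i j a b} ha hb := by
    refine grading_tensor_induction (p := fun a => L.d.rTensor A.maxIdeal (L.tensorBracket A a b) =
      L.tensorBracket A (L.d.rTensor A.maxIdeal a) b + (-1 : K) ^ i • L.tensorBracket A a (L.d.rTensor A.maxIdeal b)) ?_ (fun x hx r => ?_) (fun x y hx hy => ?_) ha
    · simp
    · refine grading_tensor_induction (p := fun b => L.d.rTensor A.maxIdeal (L.tensorBracket A (x ⊗ₜ r) b) =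
      L.tensorBracket A (L.d.rTensor A.maxIdeal (x ⊗ₜ r)) b + (-1 : K) ^ i • L.tensorBracket A (x ⊗ₜ r) (L.d.rTensor A.maxIdeal b)) ?_ (fun y hy s => ?_) (fun y z hy hz => ?_) hb
      · simp
      · simp only [tensorBracket_tmul, LinearMap.rTensor_tmul]
        rw [L.d_bracket hx hy, TensorProduct.add_tmul, TensorProduct.smul_tmul']
      · simp only [map_add, smul_add, hy, hz]; abel
    · simp only [map_add, LinearMap.add_apply, smul_add, hx, hy]; abel

theorem tensor_ad_pow_mem (L : DGLA.{u, v} K) (A : ArtAlg K) (a x : L.carrier ⊗[K] A.maxIdeal) (n : ℕ) :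
    ((L.tensorBracket A a : Module.End K (L.carrier ⊗[K] A.maxIdeal)) ^ n) x ∈
      Submodule.span K {t : L.carrier ⊗[K] A.maxIdeal |
        ∃ (y : L.carrier) (r : A.maxIdeal), (r : A.carrier) ∈ A.maxIdeal ^ n ∧ t = y ⊗ₜ r} := by
  induction n with
  | zero =>
    change x ∈ _
    induction x with
    | zero => exact zero_mem _
    | tmul y r => exact Submodule.subset_span ⟨y, r, by simp, rfl⟩
    | add y z hy hz => exact add_mem hy hz
  | succ n ih =>
    rw [pow_succ' (L.tensorBracket A a : Module.End K (L.carrier ⊗[K] A.maxIdeal)),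
      Module.End.mul_apply]
    refine Submodule.span_induction ?_ ?_ ?_ ?_ ih
    · rintro _ ⟨y, r, hr, rfl⟩
      clear ih
      induction a with
      | zero => rw [map_zero, LinearMap.zero_apply]; exact zero_mem _
      | tmul z s =>
        rw [tensorBracket_tmul]
        refine Submodule.subset_span ⟨_, _, ?_, rfl⟩
        rw [pow_succ', coe_mulMax]
        exact Ideal.mul_mem_mul s.2 hr
      | add z w hz hw => rw [map_add, LinearMap.add_apply]; exact add_mem hz hw
    · rw [map_zero]; exact zero_mem _
    · intro y z _ _ hy hz; rw [map_add]; exact add_mem hy hz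
    · intro c y _ hy; rw [map_smul]; exact Submodule.smul_mem _ _ hy

theorem tensor_adNilpotent (L : DGLA.{u, v} K) (A : ArtAlg K) : (L.tensor A).AdNilpotent := by
  intro a _
  obtain ⟨n, hn⟩ := IsArtinianRing.isNilpotent_jacobson_bot (R := A.carrier)
  rw [IsLocalRing.jacobson_eq_maximalIdeal _ bot_ne_top] at hn
  refine ⟨n, LinearMap.ext fun x => ?_⟩
  have h := L.tensor_ad_pow_mem A a x n
  have h0 : {t : L.carrier ⊗[K] A.maxIdeal | ∃ (y : L.carrier) (r : A.maxIdeal),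
      (r : A.carrier) ∈ A.maxIdeal ^ n ∧ t = y ⊗ₜ r} ⊆ {0} := by
    rintro _ ⟨y, r, hr, rfl⟩
    have hr0 : (r : A.carrier) = 0 := by
      change (r : A.carrier) ∈ (IsLocalRing.maximalIdeal A.carrier) ^ n at hr
      rw [hn] at hr; exact hr
    rw [show r = 0 from Subtype.ext hr0, TensorProduct.tmul_zero]; rfl
  have h1 := Submodule.span_mono h0 h
  rw [Submodule.span_zero_singleton] at h1
  exact h1

theorem Hom.map_tensorBracket {L N : DGLA.{u, v} K} (φ : L.Hom N) {A B : ArtAlg K} (f : A ⟶ B)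
    (a b : L.carrier ⊗[K] A.maxIdeal) :
    TensorProduct.map φ.toLinearMap (ArtAlg.Hom.maxMap f) (L.tensorBracket A a b) =
      N.tensorBracket B (TensorProduct.map φ.toLinearMap (ArtAlg.Hom.maxMap f) a)
        (TensorProduct.map φ.toLinearMap (ArtAlg.Hom.maxMap f) b) := by
  induction a with
  | zero => simp
  | tmul x r =>
    induction b with
    | zero => simp
    | tmul y s =>
      simp only [tensorBracket_tmul, TensorProduct.map_tmul, φ.map_bracket]
      congr 1
      exact Subtype.ext (map_mul f.toAlgHom _ _)
    | add y z hy hz => simp only [map_add, hy, hz]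
  | add x y hx hy => simp only [map_add, LinearMap.add_apply, hx, hy]

theorem Hom.map_rTensor_d {L N : DGLA.{u, v} K} (φ : L.Hom N) {A B : ArtAlg K} (f : A ⟶ B)
    (a : L.carrier ⊗[K] A.maxIdeal) :
    TensorProduct.map φ.toLinearMap (ArtAlg.Hom.maxMap f) (L.d.rTensor A.maxIdeal a) =
      N.d.rTensor B.maxIdeal (TensorProduct.map φ.toLinearMap (ArtAlg.Hom.maxMap f) a) := by
  induction a with
  | zero => simp
  | tmul x r => simp [φ.map_d]
  | add x y hx hy => simp only [map_add, hx, hy]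

/-- A morphism `φ : L → N` of DGLAs and a morphism `f : A → B` induce the morphism
`φ ⊗ f : L ⊗ 𝔪_A → N ⊗ 𝔪_B`. -/
noncomputable def Hom.tensor {L N : DGLA.{u, v} K} (φ : L.Hom N) {A B : ArtAlg K} (f : A ⟶ B) :
    (L.tensor A).Hom (N.tensor B) where
  toLinearMap := TensorProduct.map φ.toLinearMap (ArtAlg.Hom.maxMap f)
  map_mem {i a} ha := by
    refine grading_tensor_induction (p := fun a => TensorProduct.map φ.toLinearMap
      (ArtAlg.Hom.maxMap f) a ∈ DirectSum.decomposeTensor N.grading B.maxIdeal i)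
      ?_ (fun x hx r => ?_) (fun x y hx hy => ?_) ha
    · rw [map_zero]; exact zero_mem _
    · exact tmul_mem_grading (φ.map_mem hx) _
    · rw [map_add]; exact add_mem hx hy
  map_bracket := φ.map_tensorBracket f
  map_d := φ.map_rTensor_d f

/-- The identity morphism. -/
def Hom.id (L : DGLA.{u, v} K) : L.Hom L where
  toLinearMap := LinearMap.id
  map_mem h := h
  map_bracket _ _ := rfl
  map_d _ := rfl

theorem Hom.tensor_id_id (L : DGLA.{u, v} K) (A : ArtAlg K) :
    ((Hom.id L).tensor (𝟙 A)).toLinearMap = LinearMap.id :=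
  TensorProduct.map_id

theorem Hom.tensor_comp_apply {L M N : DGLA.{u, v} K} {A B C : ArtAlg K} (φ : L.Hom M)
    (ψ : M.Hom N) (χ : L.Hom N) (hχ : χ.toLinearMap = ψ.toLinearMap ∘ₗ φ.toLinearMap)
    (f : A ⟶ B) (g : B ⟶ C) (k : A ⟶ C) (hk : f ≫ g = k) (x : L.carrier ⊗[K] A.maxIdeal) :
    TensorProduct.map χ.toLinearMap (ArtAlg.Hom.maxMap k) x =
      TensorProduct.map ψ.toLinearMap (ArtAlg.Hom.maxMap g)
        (TensorProduct.map φ.toLinearMap (ArtAlg.Hom.maxMap f) x) := by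
  subst hk
  rw [hχ, show ArtAlg.Hom.maxMap (f ≫ g) = ArtAlg.Hom.maxMap g ∘ₗ ArtAlg.Hom.maxMap f from rfl,
    TensorProduct.map_comp, LinearMap.comp_apply]

/-- The deformation functor `Def_L = MC_L / G_L`: `Def_L(A)` is the set of gauge orbits of
Maurer-Cartan elements of `L ⊗ 𝔪_A`. -/
noncomputable def deformationFunctor (L : DGLA.{u, v} K) : ArtAlg K ⥤ Type (max u v) where
  obj A := (L.tensor A).GaugeOrbits
  map {A _} f := ↾(((Hom.id L).tensor f).gaugeOrbitsMap (L.tensor_adNilpotent A))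
  map_id A := by
    ext ⟨x⟩
    exact congrArg (Quot.mk _) (Subtype.ext (LinearMap.congr_fun (Hom.tensor_id_id L A) x.1))
  map_comp {A B _} f g := by
    ext q
    exact Hom.gaugeOrbitsMap_comp ((Hom.id L).tensor f) ((Hom.id L).tensor g)
      ((Hom.id L).tensor (f ≫ g)) (L.tensor_adNilpotent A) (L.tensor_adNilpotent B)
      (Hom.tensor_comp_apply (Hom.id L) (Hom.id L) (Hom.id L) rfl f g _ rfl) q

/-- The natural transformation `Def_φ : Def_L → Def_N` induced by a morphism `φ : L → N`. -/
noncomputable def Hom.deformationMap {L N : DGLA.{u, v} K} (φ : L.Hom N) :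
    L.deformationFunctor ⟶ N.deformationFunctor where
  app A := ↾((φ.tensor (𝟙 A)).gaugeOrbitsMap (L.tensor_adNilpotent A))
  naturality A B f := by
    ext q
    exact (Hom.gaugeOrbitsMap_comp ((Hom.id L).tensor f) (φ.tensor (𝟙 B)) (φ.tensor f)
        (L.tensor_adNilpotent A) (L.tensor_adNilpotent B) (Hom.tensor_comp_apply (Hom.id L) φ φ rfl f (𝟙 B) f (Category.comp_id f)) q).symm.trans
      (Hom.gaugeOrbitsMap_comp (φ.tensor (𝟙 A)) ((Hom.id N).tensor f) (φ.tensor f)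
        (L.tensor_adNilpotent A) (N.tensor_adNilpotent A) (Hom.tensor_comp_apply φ (Hom.id N) φ rfl (𝟙 A) f f (Category.id_comp f)) q)

end DGLA

/-!
The three statements about `φ : L → N` rest on two facts.

*Smoothness.* Let `p : B → A` be a small extension with kernel `I`. Elements of `L ⊗ I` are central
in `L ⊗ 𝔪_B`, so a Maurer-Cartan element over `A`, lifted arbitrarily to `B`, has curvature in
`L² ⊗ I`, and this is a cocycle by the Bianchi identity. If the image in `N` lifts, the class of the
curvature dies in `H²(N) ⊗ I`, hence already in `H²(L) ⊗ I`; the remaining difference between the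
image of the lift and the prescribed lift in `N` is a class in `H¹(N) ⊗ I`, which comes from
`H¹(L) ⊗ I`. This is `DGLA.Hom.isSmooth_deformationMap`; as every algebra is reached from `K` by
small extensions, `Def_φ` is then surjective (`DGLA.Hom.deformationMap_app_surjective`).

*Injectivity.* It is deduced from surjectivity for another morphism, which avoids any use of the
Baker-Campbell-Hausdorff formula. Let `M = L ×_N N[t, dt] ×_N L` be the DGLA of triples consisting of
`l, l' ∈ L` and a polynomial path in `N` from `φ(l)` to `φ(l')`. A chain of gauge transformations
from `φ(x)` to `φ(x')` gives the path `exp(t a_k) ⋯ exp(t a_1) φ(x)`, and so a Maurer-Cartan element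
of `M ⊗ 𝔪_A` lying over `(x, x')`. If `H⁰(φ)` is surjective and `H¹(φ)` is injective, then the
embedding `L → M` by constant paths is surjective on `H¹`; it is injective on `H²` because it has a
retraction. Therefore `Def_L → Def_M` is surjective, the element of `M` is gauge equivalent to a
constant path at some `z`, and projecting to the two ends gives `x ∼ z ∼ x'`
(`DGLA.Hom.deformationMap_app_injective`).

Both parts use that gauge transformations preserve Maurer-Cartan elements and that `exp(-a)` inverts
`exp(a)`. On the affine hyperplane `L¹ × {1}` of `L¹ × K` the gauge transformation by `a` is the
exponential of the nilpotent linear operator `(x, c) ↦ ([a, x] - c • da, 0)`, which is a derivation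
of the bilinear form whose diagonal is the homogenised Maurer-Cartan expression.
-/

/-! ### Exponentials of nilpotent operators -/

/-- If `D'` on `W` and `D` on `V` satisfy the Leibniz rule with respect to a bilinear map
`B : V × V → W`, then their exponentials are compatible with `B`. -/
theorem Module.End.exp_bilin_of_leibniz {R V W : Type*} [CommRing R] [AddCommGroup V] [Module R V]
    [AddCommGroup W] [Module R W] [Module ℚ V] [Module ℚ W] (B : V →ₗ[R] V →ₗ[R] W)
    (D : Module.End R V) (D' : Module.End R W) (hD : IsNilpotent D) (hD' : IsNilpotent D')
    (h : ∀ x y, D' (B x y) = B (D x) y + B x (D y)) (x y : V) :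
    IsNilpotent.exp D' (B x y) = B (IsNilpotent.exp D x) (IsNilpotent.exp D y) := by
  let DL : Module.End R (V ⊗[R] V) := D.lTensor V
  let DR : Module.End R (V ⊗[R] V) := D.rTensor V
  have h_nilL : IsNilpotent DL := hD.map <| lTensorAlgHom R V V
  have h_nilR : IsNilpotent DR := hD.map <| rTensorAlgHom R V V
  have h_comm : Commute DL DR := by ext; simp [DL, DR]
  have h₁ : IsNilpotent.exp D' (B x y) =
      TensorProduct.lift B (IsNilpotent.exp (DL + DR) (x ⊗ₜ[R] y)) := by
    suffices IsNilpotent.exp D' ∘ₗ TensorProduct.lift B =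
        TensorProduct.lift B ∘ₗ IsNilpotent.exp (DL + DR) by
      simpa using! LinearMap.congr_fun this (x ⊗ₜ[R] y)
    apply commute_exp_left_of_commute (h_comm.isNilpotent_add h_nilL h_nilR) hD'
    ext
    simp [DL, DR, h, add_comm]
  have h₂ : IsNilpotent.exp DL = (IsNilpotent.exp D).lTensor V :=
    (hD.map_exp (lTensorAlgHom R V V)).symm
  have h₃ : IsNilpotent.exp DR = (IsNilpotent.exp D).rTensor V :=
    (hD.map_exp (rTensorAlgHom R V V)).symm
  simp [h₁, IsNilpotent.exp_add_of_commute h_comm h_nilL h_nilR, h₂, h₃]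

namespace DGLA

variable {K : Type u} [Field K]

/-! ### The gauge action on Maurer-Cartan elements -/

section Gauge

variable {L : DGLA.{u, v} K}

theorem bracket_mem_one {a x : L.carrier} (ha : a ∈ L.grading 0) (hx : x ∈ L.grading 1) :
    L.bracket a x ∈ L.grading 1 := by
  simpa using L.bracket_mem ha hx

theorem d_mem_one {a : L.carrier} (ha : a ∈ L.grading 0) : L.d a ∈ L.grading 1 := by
  simpa using L.d_mem ha

theorem bracket_comm_one {x y : L.carrier} (hx : x ∈ L.grading 1) (hy : y ∈ L.grading 1) :
    L.bracket x y = L.bracket y x := by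
  have h := L.bracket_skew hx hy
  simp only [mul_one, zpow_one, neg_smul, one_smul] at h
  exact add_neg_eq_zero.mp h

/-- The infinitesimal affine gauge action of `a ∈ L⁰`, made linear: the operator
`(x, c) ↦ ([a, x] - c • da, 0)` on `L¹ × K`. -/
def affineAd (a : L.carrier) (ha : a ∈ L.grading 0) : Module.End K (L.grading 1 × K) where
  toFun u := (⟨L.bracket a u.1 - u.2 • L.d a,
    sub_mem (bracket_mem_one ha u.1.2) (Submodule.smul_mem _ _ (d_mem_one ha))⟩, 0)
  map_add' u w := by
    refine Prod.ext (Subtype.ext ?_) (by simp)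
    simp only [Prod.fst_add, Prod.snd_add, Submodule.coe_add, map_add, add_smul]
    abel
  map_smul' c u := by
    refine Prod.ext (Subtype.ext ?_) (by simp)
    simp [smul_sub, mul_smul]

theorem coe_affineAd_fst (a : L.carrier) (ha : a ∈ L.grading 0) (u : L.grading 1 × K) :
    ((affineAd a ha u).1 : L.carrier) = L.bracket a u.1 - u.2 • L.d a := rfl

theorem affineAd_neg (a : L.carrier) (ha : a ∈ L.grading 0) :
    affineAd (-a) (neg_mem ha) = -affineAd a ha := by
  refine LinearMap.ext fun u => Prod.ext (Subtype.ext ?_) (by simp [affineAd])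
  simp [affineAd]
  abel

theorem affineAd_pow_succ (a : L.carrier) (ha : a ∈ L.grading 0) (u : L.grading 1 × K) (n : ℕ) :
    (((affineAd a ha ^ (n + 1)) u).1 : L.carrier) =
      ((L.bracket a : Module.End K L.carrier) ^ n) (L.bracket a u.1 - u.2 • L.d a) ∧
    ((affineAd a ha ^ (n + 1)) u).2 = 0 := by
  induction n with
  | zero => simp [affineAd]
  | succ n ih =>
    rw [pow_succ' (affineAd a ha), Module.End.mul_apply,
      pow_succ' (L.bracket a : Module.End K L.carrier), Module.End.mul_apply, ← ih.1]
    exact ⟨by rw [coe_affineAd_fst, ih.2, zero_smul, sub_zero], rfl⟩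

theorem isNilpotent_affineAd (hL : L.AdNilpotent) (a : L.carrier) (ha : a ∈ L.grading 0) :
    IsNilpotent (affineAd a ha) := by
  obtain ⟨m, hm⟩ := hL a ha
  refine ⟨m + 1, LinearMap.ext fun u => ?_⟩
  obtain ⟨h1, h2⟩ := affineAd_pow_succ a ha u m
  exact Prod.ext (Subtype.ext (by rw [h1, hm]; rfl)) h2

/-- The exponential of `affineAd a` fixes the affine hyperplane `L¹ × {1}`, where it is the gauge
transformation by `a`. -/
theorem exp_affineAd [CharZero K] [Module ℚ L.carrier] (hL : L.AdNilpotent) (a : L.carrier)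
    (ha : a ∈ L.grading 0) (x : L.carrier) (hx : x ∈ L.grading 1) [Module ℚ (L.grading 1 × K)] :
    ((IsNilpotent.exp (affineAd a ha) (⟨x, hx⟩, 1)).1 : L.carrier) = L.gauge a x ∧
      (IsNilpotent.exp (affineAd a ha) (⟨x, hx⟩, 1)).2 = 1 := by
  obtain ⟨m, hm⟩ := hL a ha
  have hm' : affineAd a ha ^ (m + 1) = 0 := by
    refine LinearMap.ext fun u => ?_
    obtain ⟨h1, h2⟩ := affineAd_pow_succ a ha u m
    exact Prod.ext (Subtype.ext (by rw [h1, hm]; rfl)) h2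
  have hsum : IsNilpotent.exp (affineAd a ha) (⟨x, hx⟩, 1) =
      ((⟨x, hx⟩ : L.grading 1), (1 : K)) + ∑ i ∈ Finset.range m,
        ((i + 1).factorial : K)⁻¹ • (affineAd a ha ^ (i + 1)) (⟨x, hx⟩, 1) := by
    rw [IsNilpotent.exp_eq_sum hm', Finset.sum_range_succ', LinearMap.add_apply,
      LinearMap.sum_apply, add_comm]
    simp [inv_natCast_smul_eq ℚ K]
  have hfin : ∑ᶠ n : ℕ, ((n + 1).factorial : K)⁻¹ •
      ((L.bracket a : Module.End K L.carrier) ^ n) (L.bracket a x - L.d a) =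
      ∑ n ∈ Finset.range m, ((n + 1).factorial : K)⁻¹ •
      ((L.bracket a : Module.End K L.carrier) ^ n) (L.bracket a x - L.d a) := by
    refine finsum_eq_sum_of_support_subset _ fun n hn => ?_
    by_contra h
    refine hn ?_
    have h' : m ≤ n := by simpa using h
    simp only [pow_eq_zero_of_le h' hm, LinearMap.zero_apply, smul_zero]
  rw [hsum, gauge, hfin]
  constructor
  · simp [Prod.fst_sum, (affineAd_pow_succ a ha _ _).1]
  · simp [Prod.snd_sum, (affineAd_pow_succ a ha _ _).2]

/-- A `K`-vector space over a field of characteristic zero is a rational vector space. -/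
@[reducible]
noncomputable def ratModule (K V : Type*) [Field K] [CharZero K] [AddCommGroup V] [Module K V] :
    Module ℚ V :=
  Module.compHom V (algebraMap ℚ K)

theorem gauge_mem [CharZero K] (hL : L.AdNilpotent) {a x : L.carrier}
    (ha : a ∈ L.grading 0) (hx : x ∈ L.grading 1) : L.gauge a x ∈ L.grading 1 := by
  let _ := ratModule K L.carrier
  let _ := ratModule K (L.grading 1 × K)
  rw [← (exp_affineAd hL a ha x hx).1]
  exact Subtype.prop _

theorem gauge_neg_gauge [CharZero K] (hL : L.AdNilpotent) {a x : L.carrier}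
    (ha : a ∈ L.grading 0) (hx : x ∈ L.grading 1) : L.gauge (-a) (L.gauge a x) = x := by
  let _ := ratModule K L.carrier
  let _ := ratModule K (L.grading 1 × K)
  have h := exp_affineAd hL a ha x hx
  have h' := exp_affineAd hL (-a) (neg_mem ha) (L.gauge a x) (gauge_mem hL ha hx)
  have e : IsNilpotent.exp (affineAd a ha) (⟨x, hx⟩, 1) =
      (⟨L.gauge a x, gauge_mem hL ha hx⟩, 1) := Prod.ext (Subtype.ext h.1) h.2
  rw [← h'.1, affineAd_neg a ha, ← e, ← Module.End.mul_apply,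
    IsNilpotent.exp_neg_mul_exp_self (isNilpotent_affineAd hL a ha)]
  rfl

variable (L) in
/-- The polarised Maurer-Cartan expression, homogenised: a symmetric bilinear form on `L¹ × K`
whose value on the diagonal at `(x, 1)` is `[x, x] + 2 dx`. -/
def mcForm : (L.grading 1 × K) →ₗ[K] (L.grading 1 × K) →ₗ[K] L.carrier :=
  LinearMap.mk₂ K (fun u w => L.bracket u.1 w.1 + u.2 • L.d w.1 + w.2 • L.d u.1)
    (fun _ _ _ => by simp [add_smul]; abel)
    (fun c u w => by simp [mul_smul, smul_add, smul_comm w.2 c])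
    (fun _ _ _ => by simp [add_smul]; abel)
    (fun c u w => by simp [mul_smul, smul_add, smul_comm u.2 c])

theorem mcForm_leibniz (a : L.carrier) (ha : a ∈ L.grading 0) (u w : L.grading 1 × K) :
    L.bracket a (L.mcForm u w) =
      L.mcForm (affineAd a ha u) w + L.mcForm u (affineAd a ha w) := by
  obtain ⟨⟨x, hx⟩, c⟩ := u
  obtain ⟨⟨y, hy⟩, e⟩ := w
  have h1 := L.jacobi ha hx hy
  have h2 := L.d_bracket ha hx
  have h3 := L.d_bracket ha hy
  have h4 := bracket_comm_one hx (d_mem_one ha)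
  simp only [zero_mul, zpow_zero, one_smul] at h1 h2 h3
  simp only [mcForm, affineAd, LinearMap.mk₂_apply, LinearMap.coe_mk, AddHom.coe_mk, map_add,
    map_smul, map_sub, LinearMap.sub_apply, LinearMap.smul_apply, h1, h2, h3, L.d_d, h4]
  simp
  abel

theorem mcForm_diag_eq_zero_iff [CharZero K] (x : L.carrier) (hx : x ∈ L.grading 1) :
    L.mcForm (⟨x, hx⟩, 1) (⟨x, hx⟩, 1) = 0 ↔ x ∈ L.MaurerCartan := by
  have e : L.mcForm (⟨x, hx⟩, 1) (⟨x, hx⟩, 1) =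
      (2 : K) • (L.d x + (2 : K)⁻¹ • L.bracket x x) := by
    simp only [mcForm, LinearMap.mk₂_apply, one_smul, smul_add, smul_smul]
    rw [mul_inv_cancel₀ two_ne_zero, one_smul, two_smul]
    abel
  rw [e, smul_eq_zero_iff_right two_ne_zero]
  exact ⟨fun h => ⟨hx, h⟩, fun h => h.2⟩

/-- Gauge transformations preserve Maurer-Cartan elements: `exp(ad a)` is compatible with the form
`mcForm`. -/
theorem gauge_mem_maurerCartan [CharZero K] (hL : L.AdNilpotent) {a x : L.carrier}
    (ha : a ∈ L.grading 0) (hx : x ∈ L.MaurerCartan) : L.gauge a x ∈ L.MaurerCartan := by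
  let _ := ratModule K L.carrier
  let _ := ratModule K (L.grading 1 × K)
  have h := exp_affineAd hL a ha x hx.1
  have e : IsNilpotent.exp (affineAd a ha) (⟨x, hx.1⟩, 1) =
      (⟨L.gauge a x, gauge_mem hL ha hx.1⟩, 1) := Prod.ext (Subtype.ext h.1) h.2
  rw [← mcForm_diag_eq_zero_iff _ (gauge_mem hL ha hx.1), ← e,
    ← Module.End.exp_bilin_of_leibniz L.mcForm (affineAd a ha) (L.bracket a)
      (isNilpotent_affineAd hL a ha) (hL a ha) (mcForm_leibniz a ha),
    (mcForm_diag_eq_zero_iff x hx.1).mpr hx, map_zero]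

@[simp]
theorem gauge_zero (x : L.carrier) : L.gauge 0 x = x := by
  simp [gauge]

/-- The gauge transformation by an element with vanishing adjoint action is a translation. -/
theorem gauge_of_bracket_eq_zero {a : L.carrier} (h : L.bracket a = 0) (x : L.carrier) :
    L.gauge a x = x - L.d a := by
  rw [gauge, finsum_eq_single _ 0, h]
  · simp [sub_eq_add_neg]
  · intro n hn
    rw [h, zero_pow hn]
    simp

end Gauge

end DGLA

/-! ### Coordinates in a tensor product with a vector space -/

section Coordinates

variable {K : Type u} [Field K] {E F : Type v} [AddCommGroup E] [Module K E] [AddCommGroup F]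
  [Module K F] {V : Type u} [AddCommGroup V] [Module K V]

variable (E) in
/-- The contraction `E ⊗ V → E`, `e ⊗ v ↦ β(v) e`, by a linear functional `β` on `V`. -/
noncomputable def TensorProduct.contractFunctional (β : V →ₗ[K] K) : E ⊗[K] V →ₗ[K] E :=
  (TensorProduct.rid K E).toLinearMap ∘ₗ β.lTensor E

@[simp]
theorem TensorProduct.contractFunctional_tmul (β : V →ₗ[K] K) (e : E) (r : V) :
    contractFunctional E β (e ⊗ₜ r) = β r • e := by
  simp [contractFunctional]

theorem TensorProduct.contractFunctional_map (β : V →ₗ[K] K) (f : E →ₗ[K] F) (x : E ⊗[K] V) :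
    contractFunctional F β (TensorProduct.map f LinearMap.id x) = f (contractFunctional E β x) := by
  induction x with
  | zero => simp
  | tmul x r => simp
  | add x y hx hy => simp only [map_add, hx, hy]

/-- Elements of `E ⊗ J ⊆ E ⊗ V` are expanded along a basis `b` of `J`, with coefficients computed
by functionals `β` on the whole of `V`. The same `b` and `β` serve for all `E`, and the index set
of the expansion may be enlarged, which allows to expand two elements simultaneously. -/
theorem Submodule.exists_tensor_expansion (J : Submodule K V) :
    ∃ (ι : Type u) (b : ι → V) (β : ι → V →ₗ[K] K), (∀ k, b k ∈ J) ∧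
      ∀ (E : Type v) [AddCommGroup E] [Module K E] (x : E ⊗[K] V),
        x ∈ LinearMap.range (J.subtype.lTensor E) → ∃ s : Finset ι, ∀ t, s ⊆ t →
          x = ∑ k ∈ t, TensorProduct.contractFunctional E (β k) x ⊗ₜ b k := by
  classical
  obtain ⟨π, hπ⟩ := J.subtype.exists_leftInverse_of_injective (by simp)
  let b := Module.Basis.ofVectorSpace K J
  have hπ' : ∀ r : J, π r = r := fun r => LinearMap.congr_fun hπ r
  refine ⟨_, fun k => b k, fun k => b.coord k ∘ₗ π, fun k => (b k).2, ?_⟩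
  rintro E _ _ x ⟨y, rfl⟩
  induction y with
  | zero => exact ⟨∅, fun t _ => by simp⟩
  | tmul e r =>
    refine ⟨(b.repr r).support, fun t ht => ?_⟩
    have hr : ∑ k ∈ t, b.repr r k • (b k : V) = r := by
      rw [← Finset.sum_subset ht fun k _ hk => by
        rw [Finsupp.notMem_support_iff.mp hk, zero_smul]]
      conv_rhs => rw [← b.linearCombination_repr r, Finsupp.linearCombination_apply, Finsupp.sum]
      simp
    simp only [LinearMap.lTensor_tmul, contractFunctional_tmul, Submodule.subtype_apply,
      LinearMap.comp_apply, hπ', Module.Basis.coord_apply, TensorProduct.smul_tmul]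
    rw [← TensorProduct.tmul_sum, hr]
  | add y z hy hz =>
    obtain ⟨s, hs⟩ := hy
    obtain ⟨s', hs'⟩ := hz
    refine ⟨s ∪ s', fun t ht => ?_⟩
    simp only [map_add, TensorProduct.add_tmul, Finset.sum_add_distrib]
    rw [← hs t (Finset.subset_union_left.trans ht), ← hs' t (Finset.subset_union_right.trans ht)]

end Coordinates

namespace DGLA

variable {K : Type u} [Field K]

open ArtAlg

/-! ### Small extensions -/

theorem contractFunctional_mem {L : DGLA.{u, v} K} {V : Type u} [AddCommGroup V] [Module K V]
    (β : V →ₗ[K] K) {i : ℤ} {x : L.carrier ⊗[K] V}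
    (hx : x ∈ DirectSum.decomposeTensor L.grading V i) :
    TensorProduct.contractFunctional L.carrier β x ∈ L.grading i := by
  refine grading_tensor_induction
    (p := fun x => TensorProduct.contractFunctional L.carrier β x ∈ L.grading i)
    ?_ (fun x hx r => ?_) (fun x y hx hy => ?_) hx
  · rw [map_zero]; exact zero_mem _
  · rw [TensorProduct.contractFunctional_tmul]; exact Submodule.smul_mem _ _ hx
  · rw [map_add]; exact add_mem hx hy

theorem maxMap_surjective {A B : ArtAlg K} {p : B ⟶ A} (hp : Function.Surjective p.toAlgHom) :
    Function.Surjective (ArtAlg.Hom.maxMap p) := by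
  rintro ⟨r, hr⟩
  obtain ⟨b, rfl⟩ := hp r
  refine ⟨⟨b, ?_⟩, rfl⟩
  rw [IsLocalRing.mem_maximalIdeal] at hr ⊢
  exact fun h => hr (h.map p.toAlgHom)

variable (L N : DGLA.{u, v} K) {A B : ArtAlg K}

/-- The map `L ⊗ 𝔪_B → L ⊗ 𝔪_A` induced by `p : B → A`. -/
noncomputable abbrev baseChange (p : B ⟶ A) : (L.tensor B).Hom (L.tensor A) :=
  (Hom.id L).tensor p

variable {L N}

/-- The map `φ ⊗ 1 : L ⊗ 𝔪_A → N ⊗ 𝔪_A`. -/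
noncomputable abbrev Hom.onTensor (φ : L.Hom N) (A : ArtAlg K) : (L.tensor A).Hom (N.tensor A) :=
  φ.tensor (𝟙 A)

theorem Hom.baseChange_onTensor (φ : L.Hom N) (p : B ⟶ A) (x : L.carrier ⊗[K] B.maxIdeal) :
    (N.baseChange p).toLinearMap ((φ.onTensor B).toLinearMap x) =
      (φ.onTensor A).toLinearMap ((L.baseChange p).toLinearMap x) :=
  (Hom.tensor_comp_apply φ (Hom.id N) φ rfl (𝟙 B) p p (Category.id_comp p) x).symm.trans
    (Hom.tensor_comp_apply (Hom.id L) φ φ rfl p (𝟙 A) p (Category.comp_id p) x)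

theorem exists_lift {p : B ⟶ A} (hp : Function.Surjective p.toAlgHom) {i : ℤ}
    {x : L.carrier ⊗[K] A.maxIdeal} (hx : x ∈ (L.tensor A).grading i) :
    ∃ y ∈ (L.tensor B).grading i, (L.baseChange p).toLinearMap y = x := by
  refine grading_tensor_induction
    (p := fun x => ∃ y ∈ (L.tensor B).grading i, (L.baseChange p).toLinearMap y = x)
    ?_ (fun x hx r => ?_) (fun x y hx hy => ?_) hx
  · exact ⟨0, zero_mem _, map_zero _⟩
  · obtain ⟨s, rfl⟩ := maxMap_surjective hp r
    exact ⟨x ⊗ₜ s, tmul_mem_grading hx s, rfl⟩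
  · obtain ⟨x', hx', rfl⟩ := hx
    obtain ⟨y', hy', rfl⟩ := hy
    exact ⟨x' + y', add_mem hx' hy', map_add _ _ _⟩

theorem mem_range_of_baseChange_eq_zero {p : B ⟶ A} (hp : Function.Surjective p.toAlgHom)
    {x : L.carrier ⊗[K] B.maxIdeal} (hx : (L.baseChange p).toLinearMap x = 0) :
    x ∈ LinearMap.range
      ((LinearMap.ker (ArtAlg.Hom.maxMap p)).subtype.lTensor L.carrier) :=
  (lTensor_exact L.carrier (LinearMap.exact_subtype_ker_map (ArtAlg.Hom.maxMap p))
    (maxMap_surjective hp) x).mp hx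

theorem mulMax_eq_zero {p : B ⟶ A} (hp : IsSmallExtension p) (r : B.maxIdeal)
    {s : B.maxIdeal} (hs : ArtAlg.Hom.maxMap p s = 0) : B.mulMax r s = 0 :=
  Subtype.ext (hp.2 r.1 r.2 s.1 (congrArg Subtype.val hs))

theorem bracket_eq_zero_of_baseChange_eq_zero {p : B ⟶ A} (hp : IsSmallExtension p)
    {x : L.carrier ⊗[K] B.maxIdeal} (hx : (L.baseChange p).toLinearMap x = 0)
    (z : L.carrier ⊗[K] B.maxIdeal) :
    (L.tensor B).bracket z x = 0 ∧ (L.tensor B).bracket x z = 0 := by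
  obtain ⟨y, rfl⟩ := mem_range_of_baseChange_eq_zero hp.1 hx
  clear hx
  induction y with
  | zero => simp
  | tmul e r =>
    induction z with
    | zero => simp
    | tmul e' r' =>
      have h := mulMax_eq_zero hp r' r.2
      constructor
      · change L.bracket e' e ⊗ₜ B.mulMax r' r = 0
        rw [h, TensorProduct.tmul_zero]
      · change L.bracket e e' ⊗ₜ B.mulMax r r' = 0
        rw [B.mulMax_comm, h, TensorProduct.tmul_zero]
    | add x y hx hy => simp only [map_add, LinearMap.add_apply, hx, hy, add_zero, and_self]
  | add x y hx hy => simp only [map_add, LinearMap.add_apply, hx, hy, add_zero, and_self]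

/-- Surjectivity of `Hⁱ(φ)` in terms of elements, with `i = j + 1`. -/
theorem Hom.exists_of_cohomologyMap_surjective (φ : L.Hom N) {i j : ℤ} (hij : j + 1 = i)
    (h : Function.Surjective (φ.cohomologyMap i)) {c : N.carrier} (hc : c ∈ N.grading i)
    (hdc : N.d c = 0) :
    ∃ z ∈ L.grading i, L.d z = 0 ∧ ∃ w ∈ N.grading j, c = φ.toLinearMap z + N.d w := by
  obtain rfl : j = i - 1 := by omega
  obtain ⟨q, hq⟩ := h (Submodule.Quotient.mk ⟨c, hc, hdc⟩)
  obtain ⟨⟨z, hz, hdz⟩, rfl⟩ := Submodule.Quotient.mk_surjective _ q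
  obtain ⟨w, hw, hwe⟩ := (Submodule.Quotient.eq _).mp hq.symm
  refine ⟨z, hz, hdz, w, hw, ?_⟩
  have hwe' : N.d w = c - φ.toLinearMap z := hwe
  rw [hwe', add_sub_cancel]

/-- Injectivity of `Hⁱ(φ)` in terms of elements, with `i = j + 1`. -/
theorem Hom.exists_of_cohomologyMap_injective (φ : L.Hom N) {i j : ℤ} (hij : j + 1 = i)
    (h : Function.Injective (φ.cohomologyMap i)) {z : L.carrier} (hz : z ∈ L.grading i)
    (hdz : L.d z = 0) {n : N.carrier} (hn : n ∈ N.grading j) (hzn : φ.toLinearMap z = N.d n) :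
    ∃ l ∈ L.grading j, z = L.d l := by
  obtain rfl : j = i - 1 := by omega
  have h0 : (Submodule.Quotient.mk ⟨z, hz, hdz⟩ : L.cohomology i) = 0 := by
    refine h ?_
    rw [map_zero]
    exact (Submodule.Quotient.mk_eq_zero _).mpr ⟨n, hn, hzn.symm⟩
  obtain ⟨l, hl, hle⟩ := (Submodule.Quotient.mk_eq_zero _).mp h0
  exact ⟨l, hl, hle.symm⟩

theorem baseChange_sum_tmul {p : B ⟶ A} {ι : Type*} (s : Finset ι) (e : ι → L.carrier)
    (b : ι → B.maxIdeal) (hb : ∀ k, b k ∈ LinearMap.ker (ArtAlg.Hom.maxMap p)) :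
    (L.baseChange p).toLinearMap (∑ k ∈ s, e k ⊗ₜ b k) = 0 := by
  rw [map_sum]
  refine Finset.sum_eq_zero fun k _ => ?_
  change e k ⊗ₜ ArtAlg.Hom.maxMap p (b k) = 0
  rw [LinearMap.mem_ker.mp (hb k), TensorProduct.tmul_zero]

/-- Surjectivity of `Hⁱ(φ)` implies surjectivity of `Hⁱ(φ ⊗ I)`, where `I = ker p`. -/
theorem Hom.exists_of_cohomologyMap_surjective_ker (φ : L.Hom N) {i j : ℤ} (hij : j + 1 = i)
    (h : Function.Surjective (φ.cohomologyMap i)) {p : B ⟶ A}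
    (hp : Function.Surjective p.toAlgHom) {c : N.carrier ⊗[K] B.maxIdeal}
    (hc : c ∈ (N.tensor B).grading i) (hdc : (N.tensor B).d c = 0)
    (hpc : (N.baseChange p).toLinearMap c = 0) :
    ∃ z ∈ (L.tensor B).grading i, (L.tensor B).d z = 0 ∧ (L.baseChange p).toLinearMap z = 0 ∧
      ∃ w ∈ (N.tensor B).grading j, (N.baseChange p).toLinearMap w = 0 ∧
        c = (φ.onTensor B).toLinearMap z + (N.tensor B).d w := by
  obtain ⟨ι, b, β, hb, hexp⟩ := (LinearMap.ker (ArtAlg.Hom.maxMap p)).exists_tensor_expansion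
  obtain ⟨s, hs⟩ := hexp _ _ (mem_range_of_baseChange_eq_zero hp hpc)
  have hk (k : ι) := φ.exists_of_cohomologyMap_surjective hij h (contractFunctional_mem (β k) hc)
    (by
      rw [← TensorProduct.contractFunctional_map]
      exact (congrArg _ hdc).trans (map_zero _))
  choose z hz hdz w hw hzw using hk
  refine ⟨∑ k ∈ s, z k ⊗ₜ b k, sum_mem fun k _ => tmul_mem_grading (hz k) _, ?_,
    baseChange_sum_tmul s z b hb, ∑ k ∈ s, w k ⊗ₜ b k,
    sum_mem fun k _ => tmul_mem_grading (hw k) _, baseChange_sum_tmul s w b hb, ?_⟩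
  · rw [map_sum]
    refine Finset.sum_eq_zero fun k _ => ?_
    rw [LinearMap.rTensor_tmul, hdz, TensorProduct.zero_tmul]
  · rw [hs s subset_rfl, map_sum, map_sum, ← Finset.sum_add_distrib]
    refine Finset.sum_congr rfl fun k _ => ?_
    rw [hzw k, TensorProduct.add_tmul]
    rfl

/-- Injectivity of `Hⁱ(φ)` implies injectivity of `Hⁱ(φ ⊗ I)`, where `I = ker p`. -/
theorem Hom.exists_of_cohomologyMap_injective_ker (φ : L.Hom N) {i j : ℤ} (hij : j + 1 = i)
    (h : Function.Injective (φ.cohomologyMap i)) {p : B ⟶ A}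
    (hp : Function.Surjective p.toAlgHom) {z : L.carrier ⊗[K] B.maxIdeal}
    (hz : z ∈ (L.tensor B).grading i) (hdz : (L.tensor B).d z = 0)
    (hpz : (L.baseChange p).toLinearMap z = 0) {n : N.carrier ⊗[K] B.maxIdeal}
    (hn : n ∈ (N.tensor B).grading j) (hzn : (φ.onTensor B).toLinearMap z = (N.tensor B).d n) :
    ∃ l ∈ (L.tensor B).grading j, (L.baseChange p).toLinearMap l = 0 ∧ z = (L.tensor B).d l := by
  obtain ⟨ι, b, β, hb, hexp⟩ := (LinearMap.ker (ArtAlg.Hom.maxMap p)).exists_tensor_expansion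
  obtain ⟨s, hs⟩ := hexp _ _ (mem_range_of_baseChange_eq_zero hp hpz)
  have hk (k : ι) := φ.exists_of_cohomologyMap_injective hij h (contractFunctional_mem (β k) hz)
    (by
      rw [← TensorProduct.contractFunctional_map]
      exact (congrArg _ hdz).trans (map_zero _)) (contractFunctional_mem (β k) hn) (by
      rw [← TensorProduct.contractFunctional_map, ← TensorProduct.contractFunctional_map]
      exact congrArg _ hzn)
  choose l hl hzl using hk
  refine ⟨∑ k ∈ s, l k ⊗ₜ b k, sum_mem fun k _ => tmul_mem_grading (hl k) _,
    baseChange_sum_tmul s l b hb, ?_⟩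
  rw [hs s subset_rfl, map_sum]
  refine Finset.sum_congr rfl fun k _ => ?_
  rw [hzl k]
  rfl

end DGLA

namespace DGLA

variable {K : Type u} [Field K]

open ArtAlg

/-! ### Smoothness -/

section Curvature

variable {L N : DGLA.{u, v} K}

variable (L) in
/-- The curvature `dx + ½[x, x]`, whose zeros in `L¹` are the Maurer-Cartan elements. -/
def curvature (x : L.carrier) : L.carrier := L.d x + (2 : K)⁻¹ • L.bracket x x

theorem curvature_mem {x : L.carrier} (hx : x ∈ L.grading 1) : L.curvature x ∈ L.grading 2 :=
  add_mem (L.d_mem hx) (Submodule.smul_mem _ _ (L.bracket_mem hx hx))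

theorem Hom.map_curvature (φ : L.Hom N) (x : L.carrier) :
    φ.toLinearMap (L.curvature x) = N.curvature (φ.toLinearMap x) := by
  simp [curvature, φ.map_d, φ.map_bracket]

theorem curvature_add_of_bracket_eq_zero (x : L.carrier) {n : L.carrier}
    (hn : ∀ z, L.bracket z n = 0 ∧ L.bracket n z = 0) :
    L.curvature (x + n) = L.curvature x + L.d n := by
  simp only [curvature, map_add, LinearMap.add_apply, (hn _).1, (hn _).2, add_zero]
  abel

theorem bracket_bracket_self_eq_zero [CharZero K] {x : L.carrier} (hx : x ∈ L.grading 1) :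
    L.bracket x (L.bracket x x) = 0 ∧ L.bracket (L.bracket x x) x = 0 := by
  have h1 := L.jacobi hx hx hx
  have h2 := L.bracket_skew (L.bracket_mem hx hx) hx
  simp only [mul_one, zpow_one, neg_smul, one_smul] at h1 h2
  rw [show ((1 : ℤ) + 1) = (2 : ℕ) from rfl, zpow_natCast, neg_one_sq, one_smul] at h2
  rw [eq_neg_of_add_eq_zero_left h2] at h1 ⊢
  have h3 : (3 : K) • L.bracket x (L.bracket x x) = 0 := by
    rw [show (3 : K) = 1 + 1 + 1 by norm_num, add_smul, add_smul, one_smul]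
    nth_rewrite 1 [h1]
    abel
  have h4 := (smul_eq_zero_iff_right (by norm_num)).mp h3
  exact ⟨h4, by rw [h4, neg_zero]⟩

/-- The Bianchi identity, for an element with central curvature. -/
theorem d_curvature_eq_zero [CharZero K] {x : L.carrier} (hx : x ∈ L.grading 1)
    (h : ∀ z, L.bracket z (L.curvature x) = 0 ∧ L.bracket (L.curvature x) z = 0) :
    L.d (L.curvature x) = 0 := by
  have hdx : L.d x = L.curvature x - (2 : K)⁻¹ • L.bracket x x := by simp [curvature]
  have h0 := bracket_bracket_self_eq_zero hx
  rw [curvature, map_add, L.d_d, map_smul, L.d_bracket hx hx, hdx]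
  simp [(h x).1, (h x).2, h0.1, h0.2]

end Curvature

variable {L N : DGLA.{u, v} K} {A B : ArtAlg K} [CharZero K]

/-- A gauge transformation over `A` lifts along a surjection `B → A`. -/
theorem GaugeRel.exists_lift {p : B ⟶ A} (hp : Function.Surjective p.toAlgHom)
    {w w' : (L.tensor A).MaurerCartan} (h : (L.tensor A).GaugeRel w w')
    {y : (L.tensor B).MaurerCartan} (hy : (L.baseChange p).maurerCartanMap y = w) :
    ∃ y' : (L.tensor B).MaurerCartan, (L.tensor B).GaugeRel y y' ∧
      (L.baseChange p).maurerCartanMap y' = w' := by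
  obtain ⟨a, ha, hw'⟩ := h
  obtain ⟨b, hb, rfl⟩ := DGLA.exists_lift hp ha
  refine ⟨⟨_, gauge_mem_maurerCartan (L.tensor_adNilpotent B) hb y.2⟩, ⟨b, hb, rfl⟩,
    Subtype.ext ?_⟩
  rw [hw', ← hy]
  exact (L.baseChange p).map_gauge (L.tensor_adNilpotent B b hb) y.1

/-- The relation `GaugeRel` is symmetric: `exp(-a)` is inverse to `exp(a)`. -/
theorem GaugeRel.symm (hL : L.AdNilpotent) {x y : L.MaurerCartan} (h : L.GaugeRel x y) :
    L.GaugeRel y x := by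
  obtain ⟨a, ha, hy⟩ := h
  exact ⟨-a, neg_mem ha, by rw [hy, gauge_neg_gauge hL ha x.2.1]⟩

theorem reflTransGen_of_mk_eq (hL : L.AdNilpotent) {x y : L.MaurerCartan}
    (h : (Quot.mk _ x : L.GaugeOrbits) = Quot.mk _ y) :
    Relation.ReflTransGen L.GaugeRel x y := by
  have hs : Std.Symm L.GaugeRel := ⟨fun _ _ h => h.symm hL⟩
  rw [← Relation.EqvGen.eqvGen_eq_reflTransGen]
  exact Quot.eqvGen_exact h

/-- A chain of gauge transformations over `A` lifts along a surjection `B → A`. -/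
theorem exists_lift_of_mk_eq {p : B ⟶ A} (hp : Function.Surjective p.toAlgHom)
    {w : (L.tensor A).MaurerCartan} {y : (L.tensor B).MaurerCartan}
    (h : (Quot.mk _ ((L.baseChange p).maurerCartanMap y) : (L.tensor A).GaugeOrbits) =
      Quot.mk _ w) :
    ∃ y' : (L.tensor B).MaurerCartan,
      (Quot.mk _ y' : (L.tensor B).GaugeOrbits) = Quot.mk _ y ∧
      (L.baseChange p).maurerCartanMap y' = w := by
  have hchain := reflTransGen_of_mk_eq (L.tensor_adNilpotent A) h
  clear h
  induction hchain with
  | refl => exact ⟨y, rfl, rfl⟩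
  | tail _ hstep ih =>
    obtain ⟨y', h, hy'⟩ := ih
    obtain ⟨y'', h'', hy''⟩ := hstep.exists_lift hp hy'
    exact ⟨y'', (Quot.sound h'').symm.trans h, hy''⟩

/-- Along a small extension with kernel `I`, a Maurer-Cartan element `x` over `A` lifts to `B` as
soon as its image in `N` does: the obstruction in `H²(L) ⊗ I` dies in `H²(N) ⊗ I`. -/
theorem Hom.exists_maurerCartan_lift (φ : L.Hom N)
    (h2 : Function.Injective (φ.cohomologyMap 2)) {p : B ⟶ A} (hp : IsSmallExtension p)
    (x : (L.tensor A).MaurerCartan) (y : (N.tensor B).MaurerCartan)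
    (hxy : (N.baseChange p).toLinearMap y.1 = (φ.onTensor A).toLinearMap x.1) :
    ∃ z ∈ (L.tensor B).MaurerCartan, (L.baseChange p).toLinearMap z = x.1 := by
  obtain ⟨z, hz, hzx⟩ := DGLA.exists_lift (L := L) hp.1 x.2.1
  have hcurv : (L.baseChange p).toLinearMap ((L.tensor B).curvature z) = 0 := by
    rw [Hom.map_curvature, hzx]
    exact x.2.2
  have hcent := bracket_eq_zero_of_baseChange_eq_zero hp hcurv
  set n := (φ.onTensor B).toLinearMap z - y.1 with hn
  have hn0 : (N.baseChange p).toLinearMap n = 0 := by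
    rw [hn, map_sub, φ.baseChange_onTensor, hzx, hxy, sub_self]
  have hφz : (φ.onTensor B).toLinearMap ((L.tensor B).curvature z) = (N.tensor B).d n := by
    have e : (φ.onTensor B).toLinearMap z = y.1 + n := by rw [hn, add_sub_cancel]
    have hy : (N.tensor B).curvature y.1 = 0 := y.2.2
    rw [Hom.map_curvature, e,
      curvature_add_of_bracket_eq_zero _ (bracket_eq_zero_of_baseChange_eq_zero hp hn0), hy,
      zero_add]
  obtain ⟨l, hl, hpl, hle⟩ := φ.exists_of_cohomologyMap_injective_ker (i := 2) (j := 1) rfl h2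
    hp.1 (curvature_mem hz) (d_curvature_eq_zero hz hcent) hcurv
    (sub_mem ((φ.onTensor B).map_mem hz) y.2.1) hφz
  have hpl' : (L.baseChange p).toLinearMap (-l) = 0 := by rw [map_neg, hpl, neg_zero]
  refine ⟨z + -l, ⟨add_mem hz (neg_mem hl), ?_⟩, by rw [map_add, hpl', add_zero, hzx]⟩
  have := curvature_add_of_bracket_eq_zero z (bracket_eq_zero_of_baseChange_eq_zero hp hpl')
  rw [map_neg, ← hle, add_neg_cancel] at this
  exact this

/-- The standard smoothness criterion: `Def_φ` is smooth if `H¹(φ)` is surjective and `H²(φ)` is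
injective. -/
theorem Hom.isSmooth_deformationMap (φ : L.Hom N)
    (h1 : Function.Surjective (φ.cohomologyMap 1)) (h2 : Function.Injective (φ.cohomologyMap 2)) :
    IsSmooth φ.deformationMap := by
  rintro A B p hp ⟨y₀⟩ ⟨x⟩ hyx
  obtain ⟨y, hyy₀, hyp⟩ := exists_lift_of_mk_eq hp.1 (w := (φ.onTensor A).maurerCartanMap x)
    (y := y₀) hyx
  have hyp' : (N.baseChange p).toLinearMap y.1 = (φ.onTensor A).toLinearMap x.1 :=
    congrArg Subtype.val hyp
  obtain ⟨z, hz, hzx⟩ := φ.exists_maurerCartan_lift h2 hp x y hyp'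
  set c := (φ.onTensor B).toLinearMap z - y.1 with hc
  have hc0 : (N.baseChange p).toLinearMap c = 0 := by
    rw [hc, map_sub, φ.baseChange_onTensor, hzx, hyp', sub_self]
  have e : (φ.onTensor B).toLinearMap z = y.1 + c := by rw [hc, add_sub_cancel]
  have hdc : (N.tensor B).d c = 0 := by
    have h := curvature_add_of_bracket_eq_zero y.1
      (bracket_eq_zero_of_baseChange_eq_zero hp hc0)
    have hy : (N.tensor B).curvature y.1 = 0 := y.2.2
    have hz' : (L.tensor B).curvature z = 0 := hz.2
    rw [← e, ← Hom.map_curvature, hz', map_zero, hy, zero_add] at h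
    exact h.symm
  obtain ⟨c', hc', hdc', hpc', n, hn, hpn, hcn⟩ :=
    φ.exists_of_cohomologyMap_surjective_ker (i := 1) (j := 0) rfl h1 hp.1
      (sub_mem ((φ.onTensor B).map_mem hz.1) y.2.1) hdc hc0
  have hpc'' : (L.baseChange p).toLinearMap (-c') = 0 := by rw [map_neg, hpc', neg_zero]
  have hMC : z + -c' ∈ (L.tensor B).MaurerCartan := by
    refine ⟨add_mem hz.1 (neg_mem hc'), ?_⟩
    have h := curvature_add_of_bracket_eq_zero z (bracket_eq_zero_of_baseChange_eq_zero hp hpc'')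
    have hz' : (L.tensor B).curvature z = 0 := hz.2
    rw [map_neg, hdc', neg_zero, hz', add_zero] at h
    exact h
  refine ⟨Quot.mk _ ⟨z + -c', hMC⟩, ?_, congrArg (Quot.mk _) (Subtype.ext ?_)⟩
  · refine Eq.trans (Quot.sound ⟨n, hn, ?_⟩) hyy₀
    rw [gauge_of_bracket_eq_zero
      (LinearMap.ext fun z => (bracket_eq_zero_of_baseChange_eq_zero hp hpn z).2)]
    change y.1 = (φ.onTensor B).toLinearMap (z + -c') - _
    rw [map_add, map_neg, e, show c = _ from hcn]
    abel
  · change (L.baseChange p).toLinearMap (z + -c') = x.1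
    rw [map_add, hpc'', hzx, add_zero]

end DGLA

/-! ### Smooth maps of deformation functors are surjective -/

namespace ArtAlg

variable {K : Type u} [Field K]

/-- The quotient of an algebra in `ArtAlg K` by a proper ideal. -/
def quotient (A : ArtAlg K) (I : Ideal A.carrier) (hI : I ≠ ⊤) : ArtAlg K :=
  haveI : Nontrivial (A.carrier ⧸ I) := Ideal.Quotient.nontrivial_iff.mpr hI
  haveI : IsLocalRing (A.carrier ⧸ I) :=
    IsLocalRing.of_surjective' (Ideal.Quotient.mk I) Ideal.Quotient.mk_surjective
  { carrier := A.carrier ⧸ I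
    residue_bijective := by
      refine ⟨(algebraMap K (IsLocalRing.ResidueField (A.carrier ⧸ I))).injective, fun q => ?_⟩
      obtain ⟨r, rfl⟩ := IsLocalRing.residue_surjective q
      obtain ⟨a, rfl⟩ := Ideal.Quotient.mk_surjective r
      obtain ⟨c, hc⟩ := A.residue_bijective.2 (IsLocalRing.residue _ a)
      refine ⟨c, ?_⟩
      change IsLocalRing.residue _ (algebraMap K A.carrier c) = _ at hc
      change IsLocalRing.residue _ (Ideal.Quotient.mk I (algebraMap K A.carrier c)) = _
      rw [← sub_eq_zero, ← map_sub, IsLocalRing.residue_eq_zero_iff,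
        IsLocalRing.mem_maximalIdeal] at hc ⊢
      have := IsLocalHom.of_surjective (Ideal.Quotient.mk I) Ideal.Quotient.mk_surjective
      rw [← map_sub]
      exact fun h => hc (isUnit_of_map_unit (Ideal.Quotient.mk I) _ h) }

/-- The quotient morphism. -/
def quotientMap (A : ArtAlg K) (I : Ideal A.carrier) (hI : I ≠ ⊤) : A ⟶ A.quotient I hI :=
  ⟨Ideal.Quotient.mkₐ K I,
    haveI : Nontrivial (A.carrier ⧸ I) := Ideal.Quotient.nontrivial_iff.mpr hI
    IsLocalHom.of_surjective (Ideal.Quotient.mk I) Ideal.Quotient.mk_surjective⟩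

theorem quotientMap_surjective (A : ArtAlg K) (I : Ideal A.carrier) (hI : I ≠ ⊤) :
    Function.Surjective (A.quotientMap I hI).toAlgHom :=
  Ideal.Quotient.mk_surjective

theorem quotientMap_eq_zero_iff (A : ArtAlg K) (I : Ideal A.carrier) (hI : I ≠ ⊤)
    (x : A.carrier) : (A.quotientMap I hI).toAlgHom x = 0 ↔ x ∈ I :=
  Ideal.Quotient.eq_zero_iff_mem

/-- Induction on the length of the filtration by powers of the maximal ideal: a property of
algebras in `ArtAlg K` holds for all of them if it holds for those with vanishing maximal ideal and
is inherited along small extensions. -/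
theorem induction_smallExtension {P : ArtAlg K → Prop}
    (base : ∀ A : ArtAlg K, A.maxIdeal = ⊥ → P A)
    (step : ∀ (A B : ArtAlg K) (p : B ⟶ A), IsSmallExtension p → P A → P B) (A : ArtAlg K) :
    P A := by
  suffices H : ∀ (n : ℕ) (A : ArtAlg K), A.maxIdeal ^ (n + 1) = ⊥ → P A by
    obtain ⟨n, hn⟩ := IsArtinianRing.isNilpotent_jacobson_bot (R := A.carrier)
    rw [IsLocalRing.jacobson_eq_maximalIdeal _ bot_ne_top] at hn
    exact H n A (by rw [pow_succ, hn]; exact Ideal.bot_mul _)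
  intro n
  induction n with
  | zero => exact fun A hA => base A (by rwa [zero_add, pow_one] at hA)
  | succ n ih =>
    intro B hB
    have hI : B.maxIdeal ^ (n + 1) ≠ ⊤ := fun h =>
      Ideal.IsPrime.ne_top' (I := B.maxIdeal) (top_le_iff.mp (h ▸ Ideal.pow_le_self n.succ_ne_zero))
    refine step _ B (B.quotientMap _ hI) ⟨B.quotientMap_surjective _ hI, fun b hb x hx => ?_⟩
      (ih _ ?_)
    · rw [quotientMap_eq_zero_iff] at hx
      have := Ideal.mul_mem_mul hb hx
      rwa [← pow_succ', hB] at this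
    · have hmax : (B.quotient _ hI).maxIdeal ≤
          B.maxIdeal.map (B.quotientMap _ hI).toAlgHom := by
        intro r hr
        obtain ⟨b, rfl⟩ := B.quotientMap_surjective _ hI r
        refine Ideal.mem_map_of_mem _ ?_
        rw [IsLocalRing.mem_maximalIdeal] at hr ⊢
        exact fun h => hr (h.map (B.quotientMap _ hI).toAlgHom)
      refine le_bot_iff.mp ((Ideal.pow_right_mono hmax (n + 1)).trans ?_)
      rw [← Ideal.map_pow, Ideal.map_le_iff_le_comap]
      exact fun x hx => (B.quotientMap_eq_zero_iff _ hI x).mpr hx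

end ArtAlg

namespace DGLA

variable {K : Type u} [Field K]

open ArtAlg

theorem subsingleton_tensor (L : DGLA.{u, v} K) {A : ArtAlg K} (hA : A.maxIdeal = ⊥) :
    Subsingleton (L.carrier ⊗[K] A.maxIdeal) := by
  have : Subsingleton A.maxIdeal := by rw [hA]; infer_instance
  infer_instance

theorem zero_mem_maurerCartan (L : DGLA.{u, v} K) : 0 ∈ L.MaurerCartan :=
  ⟨zero_mem _, by simp⟩

theorem Hom.deformationMap_app_surjective [CharZero K] {L N : DGLA.{u, v} K} (φ : L.Hom N)
    (h1 : Function.Surjective (φ.cohomologyMap 1)) (h2 : Function.Injective (φ.cohomologyMap 2))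
    (A : ArtAlg K) : Function.Surjective (φ.deformationMap.app A) := by
  induction A using induction_smallExtension with
  | base A hA =>
    rintro ⟨y⟩
    have := N.subsingleton_tensor hA
    exact ⟨Quot.mk _ ⟨0, zero_mem_maurerCartan _⟩,
      congrArg (Quot.mk _) (Subtype.ext (Subsingleton.elim _ _))⟩
  | step A B p hp ih =>
    intro y
    obtain ⟨x, hx⟩ := ih (N.deformationFunctor.map p y)
    obtain ⟨z, hz, -⟩ := φ.isSmooth_deformationMap h1 h2 p hp y x hx.symm
    exact ⟨z, hz⟩

end DGLA

/-! ### Homogeneous components -/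

/-- A family of submodules is an internal direct sum as soon as there are projections to its members
which annihilate the other members and add up to the identity. -/
theorem DirectSum.isInternal_of_projections {R V : Type*} [CommRing R] [AddCommGroup V]
    [Module R V] {G : ℤ → Submodule R V} (π : ℤ → V →ₗ[R] V) (mem : ∀ i x, π i x ∈ G i)
    (same : ∀ i, ∀ x ∈ G i, π i x = x) (ne : ∀ i j, i ≠ j → ∀ x ∈ G i, π j x = 0)
    (sum : ∀ x, ∃ s : Finset ℤ, x = ∑ i ∈ s, π i x) : DirectSum.IsInternal G := by
  classical
  constructor
  · rw [injective_iff_map_eq_zero]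
    intro f hf
    have key (j : ℤ) (f : DirectSum ℤ fun i => G i) :
        π j (DirectSum.coeAddMonoidHom G f) = (f j : V) := by
      induction f using DirectSum.induction_on with
      | zero => simp
      | of i x =>
        rw [DirectSum.coeAddMonoidHom_of]
        obtain rfl | hij := eq_or_ne i j
        · rw [same _ _ x.2, DirectSum.of_eq_same]
        · rw [ne i j hij x x.2, DirectSum.of_eq_of_ne _ _ _ hij.symm]
          rfl
      | add x y hx hy => rw [map_add, map_add, hx, hy]; rfl
    ext j
    rw [← key j f, hf, map_zero]
    rfl
  · intro x
    obtain ⟨s, hs⟩ := sum x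
    refine ⟨∑ i ∈ s, DirectSum.of (fun i => G i) i ⟨π i x, mem i x⟩, ?_⟩
    rw [map_sum]
    simp only [DirectSum.coeAddMonoidHom_of]
    exact hs.symm

theorem neg_one_zpow_mul_self {K : Type*} [Field K] (i : ℤ) :
    (-1 : K) ^ i * (-1 : K) ^ i = 1 := by
  rw [← mul_zpow, neg_one_mul, neg_neg, one_zpow]

theorem neg_one_zpow_sub {K : Type*} [Field K] (i j : ℤ) :
    (-1 : K) ^ (i - j) = (-1 : K) ^ i * (-1 : K) ^ j := by
  rw [zpow_sub₀ (by simp), div_eq_mul_inv, inv_eq_of_mul_eq_one_right (neg_one_zpow_mul_self j)]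

theorem neg_one_zpow_add {K : Type*} [Field K] (i j : ℤ) :
    (-1 : K) ^ (i + j) = (-1 : K) ^ i * (-1 : K) ^ j :=
  zpow_add₀ (by simp) _ _

namespace DGLA

variable {K : Type u} [Field K] (L : DGLA.{u, v} K) {N : DGLA.{u, v} K}

/-- The linear map on `L` with given restrictions to the homogeneous components. -/
noncomputable def gradedLift {E : Type*} [AddCommGroup E] [Module K E]
    (f : ∀ i, L.grading i →ₗ[K] E) : L.carrier →ₗ[K] E :=
  DirectSum.toModule K ℤ E f ∘ₗ
    (LinearEquiv.ofBijective (DirectSum.coeLinearMap L.grading) L.isInternal).symm.toLinearMap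

theorem gradedLift_of_mem {E : Type*} [AddCommGroup E] [Module K E]
    (f : ∀ i, L.grading i →ₗ[K] E) {i : ℤ} {x : L.carrier} (hx : x ∈ L.grading i) :
    L.gradedLift f x = f i ⟨x, hx⟩ := by
  have h : (LinearEquiv.ofBijective (DirectSum.coeLinearMap L.grading) L.isInternal).symm x =
      DirectSum.lof K ℤ (fun i => L.grading i) i ⟨x, hx⟩ := by
    rw [LinearEquiv.symm_apply_eq]
    exact (DirectSum.coeLinearMap_lof (R := K) (A := L.grading) i ⟨x, hx⟩).symm
  rw [gradedLift, LinearMap.comp_apply, LinearEquiv.coe_coe, h, DirectSum.toModule_lof]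

theorem homogeneous_induction {p : L.carrier → Prop} (zero : p 0)
    (mem : ∀ i, ∀ x ∈ L.grading i, p x) (add : ∀ x y, p x → p y → p (x + y)) (x : L.carrier) :
    p x := by
  have hx : x ∈ ⨆ i, L.grading i := by
    rw [L.isInternal.submodule_iSup_eq_top]
    trivial
  exact Submodule.iSup_induction (motive := p) _ hx mem zero add

/-- The projection to the component of degree `i`. -/
noncomputable def component (i : ℤ) : L.carrier →ₗ[K] L.carrier :=
  L.gradedLift fun j => if j = i then (L.grading j).subtype else 0

theorem component_same {i : ℤ} {x : L.carrier} (hx : x ∈ L.grading i) : L.component i x = x := by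
  rw [component, gradedLift_of_mem _ _ hx, if_pos rfl]
  rfl

theorem component_ne {i j : ℤ} (hij : i ≠ j) {x : L.carrier} (hx : x ∈ L.grading i) :
    L.component j x = 0 := by
  rw [component, gradedLift_of_mem _ _ hx, if_neg hij]
  rfl

theorem component_mem (i : ℤ) (x : L.carrier) : L.component i x ∈ L.grading i := by
  induction x using L.homogeneous_induction with
  | zero => rw [map_zero]; exact zero_mem _
  | mem j x hx =>
    obtain rfl | hij := eq_or_ne j i
    · rwa [L.component_same hx]
    · rw [L.component_ne hij hx]; exact zero_mem _
  | add x y hx hy => rw [map_add]; exact add_mem hx hy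

theorem exists_sum_component (x : L.carrier) :
    ∃ s : Finset ℤ, ∀ t, s ⊆ t → x = ∑ i ∈ t, L.component i x := by
  classical
  induction x using L.homogeneous_induction with
  | zero => exact ⟨∅, fun t _ => by simp⟩
  | mem j x hx =>
    refine ⟨{j}, fun t ht => ?_⟩
    rw [Finset.sum_eq_single_of_mem j (ht (Finset.mem_singleton_self j))
      fun i _ hij => L.component_ne hij.symm hx, L.component_same hx]
  | add x y hx hy =>
    obtain ⟨s, hs⟩ := hx
    obtain ⟨s', hs'⟩ := hy
    refine ⟨s ∪ s', fun t ht => ?_⟩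
    simp only [map_add, Finset.sum_add_distrib]
    rw [← hs t (Finset.subset_union_left.trans ht), ← hs' t (Finset.subset_union_right.trans ht)]

variable {L}

theorem Hom.map_component (φ : L.Hom N) (i : ℤ) (x : L.carrier) :
    φ.toLinearMap (L.component i x) = N.component i (φ.toLinearMap x) := by
  induction x using L.homogeneous_induction with
  | zero => simp
  | mem j x hx =>
    obtain rfl | hij := eq_or_ne j i
    · rw [L.component_same hx, N.component_same (φ.map_mem hx)]
    · rw [L.component_ne hij hx, N.component_ne hij (φ.map_mem hx), map_zero]
  | add x y hx hy => simp only [map_add, hx, hy]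

variable (L) in
/-- The parity involution, `x ↦ (-1)ⁱ x` for `x` of degree `i`. -/
noncomputable def parity : L.carrier →ₗ[K] L.carrier :=
  L.gradedLift fun i => (-1 : K) ^ i • (L.grading i).subtype

theorem parity_of_mem {i : ℤ} {x : L.carrier} (hx : x ∈ L.grading i) :
    L.parity x = (-1 : K) ^ i • x := by
  rw [parity, gradedLift_of_mem _ _ hx]
  rfl

/-! ### Fibre products -/

section Pullback

variable {P Q R : DGLA.{u, v} K} (f : P.Hom Q) (g : R.Hom Q)

/-- The fibre product `P ×_Q R` of differential graded Lie algebras. -/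
@[reducible]
noncomputable def pullback : DGLA.{u, v} K where
  carrier := LinearMap.eqLocus (f.toLinearMap ∘ₗ LinearMap.fst K P.carrier R.carrier)
    (g.toLinearMap ∘ₗ LinearMap.snd K P.carrier R.carrier)
  grading i := ((P.grading i).prod (R.grading i)).comap (Submodule.subtype _)
  isInternal := by
    classical
    refine DirectSum.isInternal_of_projections
      (fun i => ((P.component i).prodMap (R.component i)).restrict fun x hx => ?_)
      ?_ ?_ ?_ ?_
    · have hx' : f.toLinearMap x.1 = g.toLinearMap x.2 := hx
      change f.toLinearMap (P.component i x.1) = g.toLinearMap (R.component i x.2)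
      rw [f.map_component, g.map_component, hx']
    · exact fun i x => ⟨P.component_mem i _, R.component_mem i _⟩
    · exact fun i x hx => Subtype.ext (Prod.ext (P.component_same hx.1) (R.component_same hx.2))
    · exact fun i j hij x hx =>
        Subtype.ext (Prod.ext (P.component_ne hij hx.1) (R.component_ne hij hx.2))
    · rintro ⟨⟨x, y⟩, h⟩
      obtain ⟨s, hs⟩ := P.exists_sum_component x
      obtain ⟨s', hs'⟩ := R.exists_sum_component y
      refine ⟨s ∪ s', Subtype.ext (Prod.ext ?_ ?_)⟩
      · rw [AddSubmonoidClass.coe_finsetSum, Prod.fst_sum]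
        exact hs _ Finset.subset_union_left
      · rw [AddSubmonoidClass.coe_finsetSum, Prod.snd_sum]
        exact hs' _ Finset.subset_union_right
  bracket := LinearMap.mk₂ K
    (fun x y => ⟨(P.bracket x.1.1 y.1.1, R.bracket x.1.2 y.1.2), by
      have hx : f.toLinearMap x.1.1 = g.toLinearMap x.1.2 := x.2
      have hy : f.toLinearMap y.1.1 = g.toLinearMap y.1.2 := y.2
      change f.toLinearMap (P.bracket _ _) = g.toLinearMap (R.bracket _ _)
      rw [f.map_bracket, g.map_bracket, hx, hy]⟩)
    (fun _ _ _ => Subtype.ext (Prod.ext (LinearMap.map_add₂ _ _ _ _) (LinearMap.map_add₂ _ _ _ _)))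
    (fun _ _ _ => Subtype.ext
      (Prod.ext (LinearMap.map_smul₂ _ _ _ _) (LinearMap.map_smul₂ _ _ _ _)))
    (fun _ _ _ => Subtype.ext (Prod.ext (map_add _ _ _) (map_add _ _ _)))
    (fun _ _ _ => Subtype.ext (Prod.ext (map_smul _ _ _) (map_smul _ _ _)))
  d := (P.d.prodMap R.d).restrict fun x hx => by
    have hx' : f.toLinearMap x.1 = g.toLinearMap x.2 := hx
    change f.toLinearMap (P.d x.1) = g.toLinearMap (R.d x.2)
    rw [f.map_d, g.map_d, hx']
  bracket_mem ha hb := ⟨P.bracket_mem ha.1 hb.1, R.bracket_mem ha.2 hb.2⟩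
  bracket_skew ha hb := Subtype.ext
    (Prod.ext (P.bracket_skew ha.1 hb.1) (R.bracket_skew ha.2 hb.2))
  jacobi ha hb hc := Subtype.ext
    (Prod.ext (P.jacobi ha.1 hb.1 hc.1) (R.jacobi ha.2 hb.2 hc.2))
  d_mem ha := ⟨P.d_mem ha.1, R.d_mem ha.2⟩
  d_d _ := Subtype.ext (Prod.ext (P.d_d _) (R.d_d _))
  d_bracket ha hb := Subtype.ext (Prod.ext (P.d_bracket ha.1 hb.1) (R.d_bracket ha.2 hb.2))

/-- The first projection of a fibre product. -/
noncomputable def pullbackFst : (pullback f g).Hom P where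
  toLinearMap := LinearMap.fst K P.carrier R.carrier ∘ₗ Submodule.subtype _
  map_mem h := h.1
  map_bracket _ _ := rfl
  map_d _ := rfl

/-- The second projection of a fibre product. -/
noncomputable def pullbackSnd : (pullback f g).Hom R where
  toLinearMap := LinearMap.snd K P.carrier R.carrier ∘ₗ Submodule.subtype _
  map_mem h := h.2
  map_bracket _ _ := rfl
  map_d _ := rfl

variable {f g} in
/-- The morphism to a fibre product with given components. -/
noncomputable def pullbackLift {S : DGLA.{u, v} K} (a : S.Hom P) (b : S.Hom R)
    (h : ∀ x, f.toLinearMap (a.toLinearMap x) = g.toLinearMap (b.toLinearMap x)) :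
    S.Hom (pullback f g) where
  toLinearMap := (a.toLinearMap.prod b.toLinearMap).codRestrict _ h
  map_mem hx := ⟨a.map_mem hx, b.map_mem hx⟩
  map_bracket _ _ := Subtype.ext (Prod.ext (a.map_bracket _ _) (b.map_bracket _ _))
  map_d _ := Subtype.ext (Prod.ext (a.map_d _) (b.map_d _))

end Pullback

/-! ### Polynomial paths -/

section Cone

/-- Adjoining a variable `τ` of degree `1` with `τ² = 0` to a DGLA `P`, along a derivation `∂` of
degree `0`: the elements are the sums `x + τ y`, written as pairs `(x, y)`, and the differential is
`d(x + τ y) = dx + τ (∂x - dy)`. Since `τ` stands on the left, the sign `(-1)^|x|` enters only in the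
bracket, `[x + τ y, x' + τ y'] = [x, x'] + τ ([y, x'] + (-1)^|x| [x, y'])`. For `P = N[t]`, `∂ = d/dt` and `τ = dt` this is `N[t, dt]`. -/
@[reducible]
noncomputable def derivationCone (P : DGLA.{u, v} K) (D : P.carrier →ₗ[K] P.carrier)
    (hmem : ∀ i, ∀ x ∈ P.grading i, D x ∈ P.grading i)
    (hleib : ∀ x y, D (P.bracket x y) = P.bracket (D x) y + P.bracket x (D y))
    (hcomm : ∀ x, D (P.d x) = P.d (D x)) : DGLA.{u, v} K where
  carrier := P.carrier × P.carrier
  grading i := (P.grading i).prod (P.grading (i - 1))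
  isInternal := by
    classical
    refine DirectSum.isInternal_of_projections
      (fun i => (P.component i).prodMap (P.component (i - 1))) ?_ ?_ ?_ ?_
    · exact fun i x => ⟨P.component_mem i _, P.component_mem _ _⟩
    · exact fun i x hx => Prod.ext (P.component_same hx.1) (P.component_same hx.2)
    · exact fun i j hij x hx =>
        Prod.ext (P.component_ne hij hx.1) (P.component_ne (by omega) hx.2)
    · rintro ⟨x, y⟩
      obtain ⟨s, hs⟩ := P.exists_sum_component x
      obtain ⟨s', hs'⟩ := P.exists_sum_component y
      refine ⟨s ∪ s'.image (· + 1), Prod.ext ?_ ?_⟩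
      · rw [Prod.fst_sum]
        exact hs _ Finset.subset_union_left
      · rw [Prod.snd_sum]
        refine (hs' ((s ∪ s'.image (· + 1)).image (· - 1)) fun j hj => ?_).trans ?_
        · refine Finset.mem_image.mpr ⟨j + 1, Finset.mem_union_right _ ?_, by omega⟩
          exact Finset.mem_image_of_mem _ hj
        · rw [Finset.sum_image fun a _ b _ h => by simpa using h]
          rfl
  bracket := LinearMap.mk₂ K
    (fun a b => (P.bracket a.1 b.1, P.bracket a.2 b.1 + P.bracket (P.parity a.1) b.2))
    (fun _ _ _ => Prod.ext (by simp) (by simp; abel))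
    (fun _ _ _ => Prod.ext (by simp) (by simp))
    (fun _ _ _ => Prod.ext (by simp) (by simp; abel))
    (fun _ _ _ => Prod.ext (by simp) (by simp))
  d := LinearMap.prod (P.d ∘ₗ LinearMap.fst K _ _)
    (D ∘ₗ LinearMap.fst K _ _ - P.d ∘ₗ LinearMap.snd K _ _)
  bracket_mem {i j a b} ha hb := by
    refine ⟨P.bracket_mem ha.1 hb.1, add_mem ?_ ?_⟩
    · have := P.bracket_mem ha.2 hb.1
      rwa [show i - 1 + j = i + j - 1 by ring] at this
    · rw [parity_of_mem ha.1]
      have := P.bracket_mem (Submodule.smul_mem _ ((-1 : K) ^ i) ha.1) hb.2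
      rwa [show i + (j - 1) = i + j - 1 by ring] at this
  bracket_skew {i j a b} ha hb := by
    refine Prod.ext (P.bracket_skew ha.1 hb.1) ?_
    have h1 := P.bracket_skew ha.2 hb.1
    have h2 := P.bracket_skew ha.1 hb.2
    rw [sub_one_mul, neg_one_zpow_sub] at h1
    rw [mul_sub_one, neg_one_zpow_sub] at h2
    have hi := neg_one_zpow_mul_self (K := K) i
    simp only [LinearMap.mk₂_apply, parity_of_mem ha.1, parity_of_mem hb.1, Prod.snd_add,
      Prod.smul_snd, map_smul, LinearMap.smul_apply, Prod.snd_zero]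
    linear_combination (norm := module) h1 + ((-1 : K) ^ i) • h2 -
      ((-1 : K) ^ (i * j)) • hi • (P.bracket b.2 a.1)
  jacobi {i j k a b c} ha hb hc := by
    refine Prod.ext (P.jacobi ha.1 hb.1 hc.1) ?_
    have h1 := P.jacobi ha.2 hb.1 hc.1
    have h2 := P.jacobi ha.1 hb.2 hc.1
    have h3 := P.jacobi ha.1 hb.1 hc.2
    rw [sub_one_mul, neg_one_zpow_sub] at h1
    rw [mul_sub_one, neg_one_zpow_sub] at h2
    have hi := neg_one_zpow_mul_self (K := K) i
    simp only [LinearMap.mk₂_apply, parity_of_mem ha.1, parity_of_mem hb.1,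
      parity_of_mem (P.bracket_mem ha.1 hb.1), Prod.snd_add, neg_one_zpow_add,
      Prod.smul_snd, map_smul, map_add, LinearMap.add_apply, LinearMap.smul_apply]
    linear_combination (norm := module) h1 + ((-1 : K) ^ i) • h2 +
      ((-1 : K) ^ i * (-1 : K) ^ j) • h3 +
      ((-1 : K) ^ (i * j)) • hi • (P.bracket b.2 (P.bracket a.1 c.1))
  d_mem {i a} ha := by
    refine ⟨P.d_mem ha.1, ?_⟩
    have h2 := P.d_mem ha.2
    rw [sub_add_cancel] at h2
    rw [add_sub_cancel_right]
    exact sub_mem (hmem _ _ ha.1) h2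
  d_d a := Prod.ext (P.d_d _) (by simp [P.d_d, hcomm])
  d_bracket {i j a b} ha hb := by
    refine Prod.ext (P.d_bracket ha.1 hb.1) ?_
    have h1 := P.d_bracket ha.2 hb.1
    have h2 := P.d_bracket ha.1 hb.2
    rw [neg_one_zpow_sub, zpow_one] at h1
    have hi := neg_one_zpow_mul_self (K := K) i
    change D (P.bracket a.1 b.1) - P.d (P.bracket a.2 b.1 + P.bracket (P.parity a.1) b.2) =
      P.bracket (D a.1 - P.d a.2) b.1 + P.bracket (P.parity (P.d a.1)) b.2 +
        (-1 : K) ^ i • (P.bracket a.2 (P.d b.1) + P.bracket (P.parity a.1) (D b.1 - P.d b.2))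
    simp only [parity_of_mem ha.1, parity_of_mem (P.d_mem ha.1), neg_one_zpow_add, zpow_one, hleib,
      map_sub, map_smul, map_add, LinearMap.smul_apply, LinearMap.sub_apply]
    linear_combination (norm := module) -h1 - ((-1 : K) ^ i) • h2 - hi • (P.bracket a.1 (D b.1))

end Cone
end DGLA

namespace DGLA

variable {K : Type u} [Field K]

section Polynomial

variable (N : DGLA.{u, v} K)

/-- The bracket `[t^m a, t^n b] = t^(m+n) [a, b]` on `N[t]`. -/
noncomputable def polyBracket :
    (ℕ →₀ N.carrier) →ₗ[K] (ℕ →₀ N.carrier) →ₗ[K] (ℕ →₀ N.carrier) :=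
  LinearMap.mk₂ K
    (fun f g => f.sum fun m a => g.sum fun n b => Finsupp.single (m + n) (N.bracket a b))
    (fun f f' g => Finsupp.sum_add_index' (by simp) (by simp [Finsupp.sum_add]))
    (fun c f g => by
      rw [Finsupp.sum_smul_index' (by simp), Finsupp.smul_sum]
      simp [Finsupp.smul_sum])
    (fun f g g' => by
      rw [← Finsupp.sum_add]
      refine Finsupp.sum_congr fun m _ => Finsupp.sum_add_index' (by simp) (by simp))
    (fun c f g => by
      rw [Finsupp.smul_sum]
      refine Finsupp.sum_congr fun m _ => ?_
      rw [Finsupp.sum_smul_index' (by simp), Finsupp.smul_sum]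
      simp)

@[simp]
theorem polyBracket_single (m n : ℕ) (a b : N.carrier) :
    N.polyBracket (Finsupp.single m a) (Finsupp.single n b) =
      Finsupp.single (m + n) (N.bracket a b) := by
  simp [polyBracket]

variable {N}

theorem poly_homogeneous_induction {i : ℤ} {p : (ℕ →₀ N.carrier) → Prop} (zero : p 0)
    (single : ∀ n, ∀ a ∈ N.grading i, p (Finsupp.single n a))
    (add : ∀ f g, p f → p g → p (f + g)) {f : ℕ →₀ N.carrier}
    (hf : f ∈ Finsupp.submodule fun _ : ℕ => N.grading i) : p f := by
  rw [← f.sum_single]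
  exact Finset.sum_induction _ p add zero fun n _ => single n _ (hf n)

theorem single_mem_poly {i : ℤ} {a : N.carrier} (ha : a ∈ N.grading i) (n : ℕ) :
    Finsupp.single n a ∈ Finsupp.submodule fun _ : ℕ => N.grading i := by
  intro m
  rw [Finsupp.single_apply]
  split_ifs
  · exact ha
  · exact zero_mem _

variable (N)

/-- The DGLA `N[t] = N ⊗ K[t]` of polynomials with coefficients in `N`. -/
@[reducible]
noncomputable def poly : DGLA.{u, v} K where
  carrier := ℕ →₀ N.carrier
  grading i := Finsupp.submodule fun _ => N.grading i
  isInternal := by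
    classical
    refine DirectSum.isInternal_of_projections
      (fun i => Finsupp.mapRange.linearMap (N.component i)) ?_ ?_ ?_ ?_
    · intro i f n
      exact N.component_mem i _
    · exact fun i f hf => Finsupp.ext fun n => N.component_same (hf n)
    · exact fun i j hij f hf => Finsupp.ext fun n => N.component_ne hij (hf n)
    · intro f
      suffices H : ∃ s : Finset ℤ, ∀ t, s ⊆ t →
          f = ∑ i ∈ t, Finsupp.mapRange.linearMap (N.component i) f from
        H.imp fun s hs => hs s subset_rfl
      induction f using Finsupp.induction_linear with
      | zero => exact ⟨∅, fun t _ => by simp⟩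
      | add x y hx hy =>
        obtain ⟨s, hs⟩ := hx
        obtain ⟨s', hs'⟩ := hy
        refine ⟨s ∪ s', fun t ht => ?_⟩
        simp only [map_add, Finset.sum_add_distrib]
        rw [← hs t (Finset.subset_union_left.trans ht),
          ← hs' t (Finset.subset_union_right.trans ht)]
      | single n a =>
        obtain ⟨s, hs⟩ := N.exists_sum_component a
        refine ⟨s, fun t ht => ?_⟩
        conv_lhs => rw [hs t ht, ← Finsupp.lsingle_apply (R := K), map_sum]
        simp
  bracket := N.polyBracket
  d := Finsupp.mapRange.linearMap N.d
  bracket_mem {i j f g} hf hg := by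
    refine poly_homogeneous_induction (p := fun f => N.polyBracket f g ∈ _) ?_ (fun m a ha => ?_)
      (fun f f' hf hf' => ?_) hf
    · rw [map_zero]; exact zero_mem _
    · refine poly_homogeneous_induction (p := fun g => N.polyBracket _ g ∈ _) ?_ (fun n b hb => ?_)
        (fun g g' hg hg' => ?_) hg
      · rw [map_zero]; exact zero_mem _
      · rw [polyBracket_single]
        exact single_mem_poly (N.bracket_mem ha hb) _
      · rw [map_add]; exact add_mem hg hg'
    · rw [map_add]; exact add_mem hf hf'
  bracket_skew {i j f g} hf hg := by
    refine poly_homogeneous_induction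
      (p := fun f => N.polyBracket f g + (-1 : K) ^ (i * j) • N.polyBracket g f = 0)
      ?_ (fun m a ha => ?_) (fun f f' hf hf' => ?_) hf
    · simp
    · refine poly_homogeneous_induction (p := fun g => N.polyBracket (Finsupp.single m a) g +
        (-1 : K) ^ (i * j) • N.polyBracket g (Finsupp.single m a) = 0)
        ?_ (fun n b hb => ?_) (fun g g' hg hg' => ?_) hg
      · simp
      · rw [polyBracket_single, polyBracket_single, add_comm n m, Finsupp.smul_single,
          ← Finsupp.single_add, N.bracket_skew ha hb, Finsupp.single_zero]
      · rw [map_add, map_add, LinearMap.add_apply, smul_add, add_add_add_comm, hg, hg', add_zero]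
    · rw [map_add, map_add, LinearMap.add_apply, smul_add, add_add_add_comm, hf, hf', add_zero]
  jacobi {i j k f g h} hf hg hh := by
    refine poly_homogeneous_induction
      (p := fun f => N.polyBracket f (N.polyBracket g h) = N.polyBracket (N.polyBracket f g) h +
        (-1 : K) ^ (i * j) • N.polyBracket g (N.polyBracket f h))
      ?_ (fun m a ha => ?_) (fun f f' hf hf' => ?_) hf
    · simp
    · refine poly_homogeneous_induction
        (p := fun g => N.polyBracket _ (N.polyBracket g h) = N.polyBracket (N.polyBracket _ g) h +
          (-1 : K) ^ (i * j) • N.polyBracket g (N.polyBracket _ h))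
        ?_ (fun n b hb => ?_) (fun g g' hg hg' => ?_) hg
      · simp
      · refine poly_homogeneous_induction
          (p := fun h => N.polyBracket _ (N.polyBracket _ h) = N.polyBracket (N.polyBracket _ _) h +
            (-1 : K) ^ (i * j) • N.polyBracket _ (N.polyBracket _ h))
          ?_ (fun l c hc => ?_) (fun h h' hh hh' => ?_) hh
        · simp
        · simp only [polyBracket_single]
          rw [← add_assoc, ← add_assoc, add_comm n m, Finsupp.smul_single, ← Finsupp.single_add,
            N.jacobi ha hb hc]
        · simp only [map_add, smul_add, hh, hh']; abel
      · simp only [map_add, LinearMap.add_apply, smul_add, hg, hg']; abel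
    · simp only [map_add, LinearMap.add_apply, smul_add, hf, hf']; abel
  d_mem {i f} hf n := N.d_mem (hf n)
  d_d f := Finsupp.ext fun n => N.d_d (f n)
  d_bracket {i j f g} hf hg := by
    refine poly_homogeneous_induction
      (p := fun f => Finsupp.mapRange.linearMap N.d (N.polyBracket f g) =
        N.polyBracket (Finsupp.mapRange.linearMap N.d f) g +
          (-1 : K) ^ i • N.polyBracket f (Finsupp.mapRange.linearMap N.d g))
      ?_ (fun m a ha => ?_) (fun f f' hf hf' => ?_) hf
    · simp
    · refine poly_homogeneous_induction
        (p := fun g => Finsupp.mapRange.linearMap N.d (N.polyBracket _ g) =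
          N.polyBracket (Finsupp.mapRange.linearMap N.d _) g +
            (-1 : K) ^ i • N.polyBracket _ (Finsupp.mapRange.linearMap N.d g))
        ?_ (fun n b hb => ?_) (fun g g' hg hg' => ?_) hg
      · simp
      · simp only [polyBracket_single, Finsupp.mapRange.linearMap_apply, Finsupp.mapRange_single]
        rw [N.d_bracket ha hb, Finsupp.smul_single, ← Finsupp.single_add]
      · simp only [map_add, smul_add, hg, hg']; abel
    · simp only [map_add, LinearMap.add_apply, smul_add, hf, hf']; abel

/-- The derivative `d/dt` on `N[t]`. -/
noncomputable def polyDeriv : (ℕ →₀ N.carrier) →ₗ[K] (ℕ →₀ N.carrier) :=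
  Finsupp.lsum K fun n => (n : K) • Finsupp.lsingle (n - 1)

@[simp]
theorem polyDeriv_single (n : ℕ) (a : N.carrier) :
    N.polyDeriv (Finsupp.single n a) = (n : K) • Finsupp.single (n - 1) a := by
  simp [polyDeriv]

theorem polyDeriv_mem (i : ℤ) (f : ℕ →₀ N.carrier) (hf : f ∈ N.poly.grading i) :
    N.polyDeriv f ∈ N.poly.grading i := by
  refine poly_homogeneous_induction (p := fun f => N.polyDeriv f ∈ N.poly.grading i)
    ?_ (fun m a ha => ?_) (fun f f' hf hf' => ?_) hf
  · rw [map_zero]; exact zero_mem _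
  · rw [polyDeriv_single]; exact Submodule.smul_mem _ _ (single_mem_poly ha _)
  · rw [map_add]; exact add_mem hf hf'

theorem polyDeriv_bracket (f g : ℕ →₀ N.carrier) :
    N.polyDeriv (N.polyBracket f g) =
      N.polyBracket (N.polyDeriv f) g + N.polyBracket f (N.polyDeriv g) := by
  induction f using Finsupp.induction_linear with
  | zero => simp
  | add f f' hf hf' => simp only [map_add, LinearMap.add_apply, hf, hf']; abel
  | single m a =>
    induction g using Finsupp.induction_linear with
    | zero => simp
    | add g g' hg hg' => simp only [map_add, hg, hg']; abel
    | single n b =>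
      simp only [polyBracket_single, polyDeriv_single, map_smul, LinearMap.smul_apply,
        Nat.cast_add, add_smul]
      congr 1
      · obtain _ | m := m
        · simp
        · rw [show m + 1 + n - 1 = m + 1 - 1 + n by omega]
      · obtain _ | n := n
        · simp
        · rw [show m + (n + 1) - 1 = m + (n + 1 - 1) by omega]

theorem polyDeriv_d (f : ℕ →₀ N.carrier) :
    N.polyDeriv (Finsupp.mapRange.linearMap N.d f) =
      Finsupp.mapRange.linearMap N.d (N.polyDeriv f) := by
  induction f using Finsupp.induction_linear with
  | zero => simp
  | add f f' hf hf' => simp only [map_add, hf, hf']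
  | single m a => simp

/-- The evaluation `N[t] → N` at `t = 0`. -/
noncomputable def polyEvalZero : N.poly.Hom N where
  toLinearMap := Finsupp.lapply 0
  map_mem hf := hf 0
  map_bracket f g := by
    change N.polyBracket f g 0 = N.bracket (f 0) (g 0)
    induction f using Finsupp.induction_linear with
    | zero => simp
    | add f f' hf hf' => simp [hf, hf']
    | single m a =>
      induction g using Finsupp.induction_linear with
      | zero => simp
      | add g g' hg hg' => simp [hg, hg']
      | single n b => obtain _ | m := m <;> obtain _ | n := n <;> simp
  map_d _ := rfl

/-- The evaluation `N[t] → N` at `t = 1`. -/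
noncomputable def polyEvalOne : N.poly.Hom N where
  toLinearMap := Finsupp.lsum K fun _ => LinearMap.id
  map_mem {i f} hf := sum_mem fun n _ => hf n
  map_bracket f g := by
    induction f using Finsupp.induction_linear with
    | zero => simp
    | add f f' hf hf' =>
      rw [map_add, map_add, map_add, LinearMap.add_apply, map_add, LinearMap.add_apply, hf, hf']
    | single m a =>
      induction g using Finsupp.induction_linear with
      | zero => simp
      | add g g' hg hg' => rw [map_add, map_add, map_add, map_add, hg, hg']
      | single n b => simp
  map_d f := by
    induction f using Finsupp.induction_linear with
    | zero => simp
    | add f f' hf hf' => rw [map_add, map_add, map_add, map_add, hf, hf']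
    | single m a => simp

/-- The DGLA `N[t, dt]` of polynomial differential forms on the line with coefficients in `N`; the
pair `(f, g)` stands for `f + dt g`. -/
@[reducible]
noncomputable def path : DGLA.{u, v} K :=
  N.poly.derivationCone N.polyDeriv N.polyDeriv_mem N.polyDeriv_bracket N.polyDeriv_d

/-- A morphism `N[t] → N` gives a morphism `N[t, dt] → N` which vanishes on `dt`. -/
noncomputable def pathEval (e : N.poly.Hom N) : N.path.Hom N where
  toLinearMap := e.toLinearMap ∘ₗ LinearMap.fst K _ _
  map_mem h := e.map_mem h.1
  map_bracket _ _ := e.map_bracket _ _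
  map_d _ := e.map_d _

/-- The inclusion of constants `N → N[t, dt]`. -/
noncomputable def pathConst : N.Hom N.path where
  toLinearMap := LinearMap.inl K _ _ ∘ₗ Finsupp.lsingle 0
  map_mem h := ⟨single_mem_poly h 0, zero_mem _⟩
  map_bracket a b := by
    refine Prod.ext ?_ ?_
    · exact (N.polyBracket_single 0 0 a b).symm
    · change 0 = N.polyBracket 0 _ + N.polyBracket _ 0
      simp
  map_d a := by
    refine Prod.ext ?_ ?_
    · exact (Finsupp.mapRange_single (hf := map_zero N.d)).symm
    · change 0 = N.polyDeriv (Finsupp.single 0 a) - Finsupp.mapRange.linearMap N.d 0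
      simp

/-- The linear map `a ↦ t a` from `N` to `N[t, dt]`. -/
noncomputable def pathLinear : N.carrier →ₗ[K] N.path.carrier :=
  LinearMap.inl K _ _ ∘ₗ Finsupp.lsingle 1

end Polynomial

end DGLA

namespace DGLA

variable {K : Type u} [Field K]

open ArtAlg

/-- Composition of morphisms. -/
def Hom.comp {L M N : DGLA.{u, v} K} (ψ : M.Hom N) (φ : L.Hom M) : L.Hom N where
  toLinearMap := ψ.toLinearMap ∘ₗ φ.toLinearMap
  map_mem h := ψ.map_mem (φ.map_mem h)
  map_bracket a b := by simp [φ.map_bracket, ψ.map_bracket]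
  map_d a := by simp [φ.map_d, ψ.map_d]

theorem Hom.comp_onTensor {L M N : DGLA.{u, v} K} (ψ : M.Hom N) (φ : L.Hom M) (A : ArtAlg K)
    (x : L.carrier ⊗[K] A.maxIdeal) :
    ((ψ.comp φ).onTensor A).toLinearMap x =
      (ψ.onTensor A).toLinearMap ((φ.onTensor A).toLinearMap x) :=
  Hom.tensor_comp_apply φ ψ (ψ.comp φ) rfl (𝟙 A) (𝟙 A) (𝟙 A) (Category.comp_id _) x

theorem Hom.deformationMap_comp_apply {L M N : DGLA.{u, v} K} (ψ : M.Hom N) (φ : L.Hom M)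
    (A : ArtAlg K) (q : L.deformationFunctor.obj A) :
    (ψ.comp φ).deformationMap.app A q = ψ.deformationMap.app A (φ.deformationMap.app A q) :=
  Hom.gaugeOrbitsMap_comp (φ.onTensor A) (ψ.onTensor A) ((ψ.comp φ).onTensor A)
    (L.tensor_adNilpotent A) (M.tensor_adNilpotent A) (ψ.comp_onTensor φ A) q

/-! ### Maurer-Cartan elements of fibre products -/

section Pullback

variable {P Q R : DGLA.{u, v} K} (f : P.Hom Q) (g : R.Hom Q) (A : ArtAlg K)

/-- Base change to `𝔪_A` commutes with fibre products, for Maurer-Cartan elements. -/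
theorem exists_maurerCartan_pullback (x : (P.tensor A).MaurerCartan)
    (y : (R.tensor A).MaurerCartan)
    (h : (f.onTensor A).toLinearMap x.1 = (g.onTensor A).toLinearMap y.1) :
    ∃ z : ((pullback f g).tensor A).MaurerCartan,
      ((pullbackFst f g).onTensor A).maurerCartanMap z = x ∧
      ((pullbackSnd f g).onTensor A).maurerCartanMap z = y := by
  classical
  obtain ⟨ι, b, β, -, hexp⟩ :=
    (⊤ : Submodule K A.maxIdeal).exists_tensor_expansion
  have htop (E : Type v) [AddCommGroup E] [Module K E] (x : E ⊗[K] A.maxIdeal) :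
      x ∈ LinearMap.range ((⊤ : Submodule K A.maxIdeal).subtype.lTensor E) :=
    LinearMap.lTensor_surjective E (fun r => ⟨⟨r, trivial⟩, rfl⟩) x
  -- the two projections are jointly injective
  have hinj (m : (pullback f g).carrier ⊗[K] A.maxIdeal)
      (h1 : ((pullbackFst f g).onTensor A).toLinearMap m = 0)
      (h2 : ((pullbackSnd f g).onTensor A).toLinearMap m = 0) : m = 0 := by
    obtain ⟨s, hs⟩ := hexp _ m (htop _ m)
    rw [hs s subset_rfl]
    refine Finset.sum_eq_zero fun k _ => ?_
    have h0 : TensorProduct.contractFunctional (pullback f g).carrier (β k) m = 0 := by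
      refine Subtype.ext (Prod.ext ?_ ?_)
      · exact ((TensorProduct.contractFunctional_map (β k) (pullbackFst f g).toLinearMap m).symm.trans
          (congrArg _ h1)).trans (map_zero _)
      · exact ((TensorProduct.contractFunctional_map (β k) (pullbackSnd f g).toLinearMap m).symm.trans
          (congrArg _ h2)).trans (map_zero _)
    rw [h0, TensorProduct.zero_tmul]
  obtain ⟨s, hs⟩ := hexp _ x.1 (htop _ x.1)
  obtain ⟨s', hs'⟩ := hexp _ y.1 (htop _ y.1)
  have hk (k : ι) : f.toLinearMap (TensorProduct.contractFunctional P.carrier (β k) x.1) =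
      g.toLinearMap (TensorProduct.contractFunctional R.carrier (β k) y.1) := by
    rw [← TensorProduct.contractFunctional_map, ← TensorProduct.contractFunctional_map]
    exact congrArg _ h
  let z : (pullback f g).carrier ⊗[K] A.maxIdeal := ∑ k ∈ s ∪ s',
    (⟨(TensorProduct.contractFunctional P.carrier (β k) x.1,
      TensorProduct.contractFunctional R.carrier (β k) y.1), hk k⟩ : (pullback f g).carrier) ⊗ₜ b k
  have hz1 : ((pullbackFst f g).onTensor A).toLinearMap z = x.1 := by
    rw [map_sum]
    exact (hs _ Finset.subset_union_left).symm
  have hz2 : ((pullbackSnd f g).onTensor A).toLinearMap z = y.1 := by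
    rw [map_sum]
    exact (hs' _ Finset.subset_union_right).symm
  have hz : z ∈ ((pullback f g).tensor A).grading 1 :=
    sum_mem fun k _ => tmul_mem_grading (L := pullback f g) (x := ⟨(_, _), hk k⟩)
      ⟨contractFunctional_mem (β k) x.2.1, contractFunctional_mem (β k) y.2.1⟩ _
  have hcurv : ((pullback f g).tensor A).curvature z = 0 := by
    refine hinj _ ?_ ?_
    · rw [Hom.map_curvature, hz1]; exact x.2.2
    · rw [Hom.map_curvature, hz2]; exact y.2.2
  exact ⟨⟨z, hz, hcurv⟩, Subtype.ext hz1, Subtype.ext hz2⟩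

end Pullback

/-! ### Gauge equivalences as polynomial paths -/

section PathMC

variable {N : DGLA.{u, v} K} {A : ArtAlg K}

theorem pathLinear_mem {i : ℤ} {a : N.carrier ⊗[K] A.maxIdeal}
    (ha : a ∈ (N.tensor A).grading i) :
    TensorProduct.map N.pathLinear LinearMap.id a ∈ (N.path.tensor A).grading i := by
  refine grading_tensor_induction
    (p := fun a => TensorProduct.map N.pathLinear LinearMap.id a ∈ (N.path.tensor A).grading i)
    ?_ (fun x hx r => ?_) (fun x y hx hy => ?_) ha
  · rw [map_zero]; exact zero_mem _
  · exact tmul_mem_grading (⟨single_mem_poly hx 1, zero_mem _⟩ : _ ∈ N.path.grading i) r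
  · rw [map_add]; exact add_mem hx hy

theorem pathEval_zero_pathLinear (a : N.carrier ⊗[K] A.maxIdeal) :
    ((N.pathEval N.polyEvalZero).onTensor A).toLinearMap
      (TensorProduct.map N.pathLinear LinearMap.id a) = 0 := by
  induction a with
  | zero => simp
  | tmul x r =>
    change (Finsupp.single 1 x : ℕ →₀ N.carrier) 0 ⊗ₜ r = 0
    rw [Finsupp.single_eq_of_ne zero_ne_one, TensorProduct.zero_tmul]
  | add x y hx hy => rw [map_add, map_add, hx, hy, add_zero]

theorem pathEval_one_pathLinear (a : N.carrier ⊗[K] A.maxIdeal) :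
    ((N.pathEval N.polyEvalOne).onTensor A).toLinearMap
      (TensorProduct.map N.pathLinear LinearMap.id a) = a := by
  induction a with
  | zero => simp
  | tmul x r =>
    change N.polyEvalOne.toLinearMap (Finsupp.single 1 x) ⊗ₜ r = x ⊗ₜ r
    simp [polyEvalOne]
  | add x y hx hy => rw [map_add, map_add, hx, hy]

theorem pathEval_pathConst (e : N.poly.Hom N)
    (he : ∀ a, e.toLinearMap (Finsupp.single 0 a) = a) (x : N.carrier ⊗[K] A.maxIdeal) :
    ((N.pathEval e).onTensor A).toLinearMap ((N.pathConst.onTensor A).toLinearMap x) = x := by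
  induction x with
  | zero => simp
  | tmul x r =>
    change e.toLinearMap (Finsupp.single 0 x) ⊗ₜ r = x ⊗ₜ r
    rw [he]
  | add x y hx hy => rw [map_add, map_add, hx, hy]

/-- A chain `exp(a_k) ⋯ exp(a_1) x` of gauge transformations is the endpoint of the polynomial path
`exp(t a_k) ⋯ exp(t a_1) x`, a Maurer-Cartan element over `N[t, dt]`. -/
theorem exists_path_of_mk_eq [CharZero K] {x y : (N.tensor A).MaurerCartan}
    (h : (Quot.mk _ x : (N.tensor A).GaugeOrbits) = Quot.mk _ y) :
    ∃ w : (N.path.tensor A).MaurerCartan,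
      ((N.pathEval N.polyEvalZero).onTensor A).maurerCartanMap w = x ∧
      ((N.pathEval N.polyEvalOne).onTensor A).maurerCartanMap w = y := by
  have hchain := reflTransGen_of_mk_eq (N.tensor_adNilpotent A) h
  clear h
  induction hchain with
  | refl =>
    exact ⟨(N.pathConst.onTensor A).maurerCartanMap x,
      Subtype.ext (pathEval_pathConst _ (fun a => by simp [polyEvalZero]) x.1),
      Subtype.ext (pathEval_pathConst _ (fun a => by simp [polyEvalOne]) x.1)⟩
  | tail _ hstep ih =>
    obtain ⟨w, hw0, hw1⟩ := ih
    obtain ⟨a, ha, hy⟩ := hstep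
    have hta := pathLinear_mem ha
    refine ⟨⟨_, gauge_mem_maurerCartan (N.path.tensor_adNilpotent A) hta w.2⟩,
      Subtype.ext ?_, Subtype.ext ?_⟩
    · refine (Hom.map_gauge _ (N.path.tensor_adNilpotent A _ hta) _).trans ?_
      rw [pathEval_zero_pathLinear, gauge_zero]
      exact congrArg Subtype.val hw0
    · refine (Hom.map_gauge _ (N.path.tensor_adNilpotent A _ hta) _).trans ?_
      rw [pathEval_one_pathLinear, hy, ← hw1]
      rfl

end PathMC

/-! ### The double mapping path space -/

section PathSpace

variable {L N : DGLA.{u, v} K}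

variable (N) in
/-- The primitive `f ↦ ∫₀ᵗ f` on `N[t]`. -/
noncomputable def polyInt : (ℕ →₀ N.carrier) →ₗ[K] (ℕ →₀ N.carrier) :=
  Finsupp.lsum K fun n => ((n : K) + 1)⁻¹ • Finsupp.lsingle (n + 1)

@[simp]
theorem polyInt_single (n : ℕ) (a : N.carrier) :
    N.polyInt (Finsupp.single n a) = ((n : K) + 1)⁻¹ • Finsupp.single (n + 1) a := by
  simp [polyInt]

theorem polyInt_mem (i : ℤ) (f : ℕ →₀ N.carrier) (hf : f ∈ N.poly.grading i) :
    N.polyInt f ∈ N.poly.grading i := by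
  refine poly_homogeneous_induction (p := fun f => N.polyInt f ∈ N.poly.grading i)
    ?_ (fun m a ha => ?_) (fun f f' hf hf' => ?_) hf
  · rw [map_zero]; exact zero_mem _
  · rw [polyInt_single]; exact Submodule.smul_mem _ _ (single_mem_poly ha _)
  · rw [map_add]; exact add_mem hf hf'

theorem polyInt_apply_zero (f : ℕ →₀ N.carrier) : N.polyInt f 0 = 0 := by
  induction f using Finsupp.induction_linear with
  | zero => simp
  | add f g hf hg => simp [hf, hg]
  | single n a => simp

theorem polyInt_d (f : ℕ →₀ N.carrier) :
    Finsupp.mapRange.linearMap N.d (N.polyInt f) =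
      N.polyInt (Finsupp.mapRange.linearMap N.d f) := by
  induction f using Finsupp.induction_linear with
  | zero => simp
  | add f g hf hg => simp only [map_add, hf, hg]
  | single n a => simp

theorem polyDeriv_polyInt [CharZero K] (f : ℕ →₀ N.carrier) : N.polyDeriv (N.polyInt f) = f := by
  induction f using Finsupp.induction_linear with
  | zero => simp
  | add f g hf hg => simp only [map_add, hf, hg]
  | single n a =>
    have : (n : K) + 1 ≠ 0 := Nat.cast_add_one_ne_zero n
    rw [polyInt_single, map_smul, polyDeriv_single, smul_smul, Nat.cast_add_one,
      inv_mul_cancel₀ this, one_smul, Nat.add_sub_cancel]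

theorem polyInt_polyDeriv [CharZero K] (f : ℕ →₀ N.carrier) :
    N.polyInt (N.polyDeriv f) = f - Finsupp.single 0 (f 0) := by
  induction f using Finsupp.induction_linear with
  | zero => simp
  | add f g hf hg => simp only [map_add, hf, hg, Finsupp.add_apply, Finsupp.single_add]; abel
  | single n a =>
    obtain _ | n := n
    · simp
    · have : (n : K) + 1 ≠ 0 := Nat.cast_add_one_ne_zero n
      rw [polyDeriv_single, map_smul, Nat.add_sub_cancel, polyInt_single, smul_smul,
        Nat.cast_add_one, mul_inv_cancel₀ this, one_smul]
      simp

/-- The space of triples `(l, p, l')` of `l, l' ∈ L` and a path `p ∈ N[t, dt]` from `φ(l)` to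
`φ(l')`. -/
@[reducible]
noncomputable def Hom.pathSpace (φ : L.Hom N) : DGLA.{u, v} K :=
  pullback ((N.pathEval N.polyEvalOne).comp (pullbackSnd φ (N.pathEval N.polyEvalZero))) φ

/-- The starting point `l` of a triple `(l, p, l')`. -/
noncomputable def Hom.pathSource (φ : L.Hom N) : φ.pathSpace.Hom L :=
  (pullbackFst φ (N.pathEval N.polyEvalZero)).comp (pullbackFst _ _)

/-- The end point `l'` of a triple `(l, p, l')`. -/
noncomputable def Hom.pathTarget (φ : L.Hom N) : φ.pathSpace.Hom L :=
  pullbackSnd _ _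

/-- The embedding of `L` by the constant paths, `l ↦ (l, φ(l), l)`. -/
noncomputable def Hom.constPath (φ : L.Hom N) : L.Hom φ.pathSpace :=
  pullbackLift (pullbackLift (Hom.id L) (N.pathConst.comp φ) fun x => by
      change φ.toLinearMap x = (Finsupp.single 0 (φ.toLinearMap x) : ℕ →₀ N.carrier) 0
      simp)
    (Hom.id L) fun x => by
      change N.polyEvalOne.toLinearMap (Finsupp.single 0 (φ.toLinearMap x)) = φ.toLinearMap x
      simp [polyEvalOne]

/-- The embedding by constant paths is injective in cohomology, as `L` is a retract of the path
space. -/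
theorem Hom.injective_cohomologyMap_constPath (φ : L.Hom N) (i : ℤ) :
    Function.Injective (φ.constPath.cohomologyMap i) := by
  rw [injective_iff_map_eq_zero]
  intro q hq
  obtain ⟨⟨z, hz⟩, rfl⟩ := Submodule.Quotient.mk_surjective _ q
  obtain ⟨w, hw, hwz⟩ := (Submodule.Quotient.mk_eq_zero _).mp hq
  refine (Submodule.Quotient.mk_eq_zero _).mpr
    ⟨φ.pathTarget.toLinearMap w, φ.pathTarget.map_mem hw, ?_⟩
  rw [← φ.pathTarget.map_d, hwz]
  rfl

/-- `H¹` of the embedding by constant paths is surjective: for a cocycle `(l, f + dt g, l')` the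
integral `∫₀¹ g` bounds `φ(l') - φ(l)`, so injectivity of `H¹(φ)` gives `l' = l + du`, and
surjectivity of `H⁰(φ)` allows to choose `u` with `φ(u)` cohomologous to `∫₀¹ g`. -/
theorem Hom.surjective_cohomologyMap_constPath [CharZero K] (φ : L.Hom N)
    (h0 : Function.Surjective (φ.cohomologyMap 0)) (h1 : Function.Injective (φ.cohomologyMap 1)) :
    Function.Surjective (φ.constPath.cohomologyMap 1) := by
  intro q
  obtain ⟨⟨⟨⟨⟨⟨l, ⟨f, g⟩⟩, hs⟩, l'⟩, ht⟩, ⟨⟨hl, hf, hg⟩, hl'⟩, hd⟩, rfl⟩ :=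
    Submodule.Quotient.mk_surjective _ q
  replace hl : l ∈ L.grading 1 := hl
  replace hl' : l' ∈ L.grading 1 := hl'
  replace hg : g ∈ N.poly.grading 0 := hg
  replace hs : φ.toLinearMap l = f 0 := hs
  replace ht : N.polyEvalOne.toLinearMap f = φ.toLinearMap l' := ht
  have hdl : L.d l = 0 := congrArg (fun m => φ.pathSource.toLinearMap m) hd
  have hdl' : L.d l' = 0 := congrArg (fun m => φ.pathTarget.toLinearMap m) hd
  have hfg : N.polyDeriv f - N.poly.d g = 0 := congrArg
    (fun m : φ.pathSpace.carrier => m.1.1.1.2.2) hd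
  set γ := N.polyEvalOne.toLinearMap (N.polyInt g) with hγ
  have hγ0 : γ ∈ N.grading 0 := N.polyEvalOne.map_mem (polyInt_mem 0 g hg)
  have hdint : N.poly.d (N.polyInt g) = f - Finsupp.single 0 (φ.toLinearMap l) := by
    rw [hs, ← polyInt_polyDeriv, sub_eq_zero.mp hfg]
    exact polyInt_d g
  have hone (a : N.carrier) (n : ℕ) : N.polyEvalOne.toLinearMap (Finsupp.single n a) = a := by
    simp [polyEvalOne]
  have hdγ : φ.toLinearMap (l' - l) = N.d γ := by
    rw [hγ, ← N.polyEvalOne.map_d, hdint, map_sub, map_sub, ht, hone]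
  obtain ⟨u, hu, hlu⟩ := φ.exists_of_cohomologyMap_injective (i := 1) (j := 0) rfl h1
    (sub_mem hl' hl) (by rw [map_sub, hdl, hdl', sub_zero]) hγ0 hdγ
  obtain ⟨z, hz, hdz, w, hw, hγw⟩ := φ.exists_of_cohomologyMap_surjective (i := 0) (j := -1) rfl h0
    (sub_mem hγ0 (φ.map_mem hu)) (by rw [map_sub, ← hdγ, hlu, φ.map_d, sub_self])
  -- the cochain `(0, ∫₀ᵗ g - t dw - dt w, u + z)` bounds the difference from a constant path
  let F : ℕ →₀ N.carrier := N.polyInt g - Finsupp.single 1 (N.d w)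
  have hF : F ∈ N.poly.grading 0 :=
    sub_mem (polyInt_mem 0 g hg) (single_mem_poly (N.d_mem hw) 1)
  have hF0 : F 0 = 0 := by simp [F, polyInt_apply_zero]
  have hF1 : N.polyEvalOne.toLinearMap F = φ.toLinearMap (u + z) := by
    rw [map_sub, hone, map_add, ← hγ, sub_eq_iff_eq_add.mp hγw]
    abel
  have hdF : N.poly.d F = f - Finsupp.single 0 (φ.toLinearMap l) := by
    rw [map_sub, hdint]
    simp [N.d_d]
  have hDF : N.polyDeriv F - N.poly.d (-Finsupp.single 0 w) = g := by
    have h : N.poly.d (Finsupp.single 0 w) = Finsupp.single 0 (N.d w) :=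
      Finsupp.mapRange_single (hf := map_zero N.d)
    rw [map_sub, polyDeriv_polyInt, polyDeriv_single, map_neg, h]
    simp
  let c : φ.pathSpace.carrier := ⟨(⟨(0, (F, -Finsupp.single 0 w)), by
    change φ.toLinearMap 0 = F 0
    rw [map_zero, hF0]⟩, u + z), hF1⟩
  have hc : c ∈ φ.pathSpace.grading 0 :=
    ⟨⟨zero_mem _, hF, neg_mem (single_mem_poly hw 0)⟩, add_mem hu hz⟩
  refine ⟨Submodule.Quotient.mk ⟨l, hl, hdl⟩, Eq.symm ((Submodule.Quotient.eq _).mpr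
    ⟨c, hc, ?_⟩)⟩
  refine Subtype.ext (Prod.ext (Subtype.ext (Prod.ext ?_ (Prod.ext ?_ ?_))) ?_)
  · change L.d 0 = l - l
    simp
  · exact hdF
  · change N.polyDeriv F - N.poly.d (-Finsupp.single 0 w) = g - 0
    rw [hDF, sub_zero]
  · change L.d (u + z) = l' - l
    rw [map_add, hdz, add_zero, hlu]

end PathSpace

/-! ### Injectivity and the isomorphism theorem -/

/-- `Def_φ` is injective if `H⁰(φ)` is surjective and `H¹(φ)` is injective: a gauge equivalence
between `φ(x)` and `φ(x')` is a Maurer-Cartan element of the path space of `φ`, and every such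
element is gauge equivalent to a constant path. -/
theorem Hom.deformationMap_app_injective [CharZero K] {L N : DGLA.{u, v} K} (φ : L.Hom N)
    (h0 : Function.Surjective (φ.cohomologyMap 0)) (h1 : Function.Injective (φ.cohomologyMap 1))
    (A : ArtAlg K) : Function.Injective (φ.deformationMap.app A) := by
  rintro ⟨x⟩ ⟨x'⟩ h
  obtain ⟨p, hp0, hp1⟩ := exists_path_of_mk_eq (N := N) (A := A)
    (x := (φ.onTensor A).maurerCartanMap x) (y := (φ.onTensor A).maurerCartanMap x') h
  obtain ⟨m, hm1, hm2⟩ := exists_maurerCartan_pullback φ (N.pathEval N.polyEvalZero) A x p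
    (congrArg Subtype.val hp0).symm
  obtain ⟨n, hn1, hn2⟩ := exists_maurerCartan_pullback
    ((N.pathEval N.polyEvalOne).comp (pullbackSnd φ (N.pathEval N.polyEvalZero))) φ A m x' (by
      rw [Hom.comp_onTensor]
      refine Eq.trans (congrArg _ ?_) (congrArg Subtype.val hp1)
      exact congrArg Subtype.val hm2)
  obtain ⟨q, hq⟩ := φ.constPath.deformationMap_app_surjective
    (φ.surjective_cohomologyMap_constPath h0 h1) (φ.injective_cohomologyMap_constPath 2) A
    (Quot.mk _ n)
  have hid (e : φ.pathSpace.Hom L) (he : ∀ l, e.toLinearMap (φ.constPath.toLinearMap l) = l) :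
      e.deformationMap.app A (Quot.mk _ n) = q := by
    rw [← hq, ← Hom.deformationMap_comp_apply]
    obtain ⟨q⟩ := q
    refine congrArg (Quot.mk _) (Subtype.ext ?_)
    have : (e.comp φ.constPath).toLinearMap = LinearMap.id := LinearMap.ext he
    change TensorProduct.map (e.comp φ.constPath).toLinearMap LinearMap.id q.1 = q.1
    rw [this, TensorProduct.map_id]
    rfl
  have hsource : φ.pathSource.deformationMap.app A (Quot.mk _ n) = Quot.mk _ x := by
    refine (Hom.deformationMap_comp_apply (pullbackFst φ (N.pathEval N.polyEvalZero))
      (pullbackFst _ φ) A (Quot.mk _ n)).trans ?_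
    refine (congrArg (fun z => (pullbackFst φ (N.pathEval N.polyEvalZero)).deformationMap.app A
      (Quot.mk _ z)) hn1).trans ?_
    exact congrArg (Quot.mk _) hm1
  have htarget : φ.pathTarget.deformationMap.app A (Quot.mk _ n) = Quot.mk _ x' :=
    congrArg (Quot.mk _) hn2
  rw [← hsource, ← htarget, hid _ fun _ => rfl, hid _ fun _ => rfl]

theorem Hom.isIso_deformationMap [CharZero K] {L N : DGLA.{u, v} K} (φ : L.Hom N)
    (h0 : Function.Surjective (φ.cohomologyMap 0)) (h1 : Function.Bijective (φ.cohomologyMap 1))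
    (h2 : Function.Injective (φ.cohomologyMap 2)) : IsIso φ.deformationMap := by
  rw [NatTrans.isIso_iff_isIso_app]
  intro A
  rw [isIso_iff_bijective]
  exact ⟨φ.deformationMap_app_injective h0 h1.1 A, φ.deformationMap_app_surjective h1.2 h2 A⟩

end DGLA

theorem mainTheorem4 {K : Type u} [Field K] [CharZero K] :
    (∀ (L N : DGLA.{u, v} K) (φ : L.Hom N),
      (Function.Surjective (φ.cohomologyMap 1) → Function.Injective (φ.cohomologyMap 2) →
        ArtAlg.IsSmooth φ.deformationMap) ∧
      (Function.Surjective (φ.cohomologyMap 0) → Function.Bijective (φ.cohomologyMap 1) →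
        Function.Injective (φ.cohomologyMap 2) → IsIso φ.deformationMap) ∧
      (φ.IsQuasiIso → IsIso φ.deformationMap)) ∧
    (∀ L N : DGLA.{u, v} K, L.QuasiIsomorphic N →
      Nonempty (L.deformationFunctor ≅ N.deformationFunctor)) := by
  refine ⟨fun L N φ => ⟨φ.isSmooth_deformationMap, φ.isIso_deformationMap,
    fun h => φ.isIso_deformationMap (h 0).2 (h 1) (h 2).1⟩, fun L N h => ?_⟩
  induction h with
  | rel L N h =>
    obtain ⟨φ, hφ⟩ := h
    have := φ.isIso_deformationMap (hφ 0).2 (hφ 1) (hφ 2).1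
    exact ⟨asIso φ.deformationMap⟩
  | refl L => exact ⟨Iso.refl _⟩
  | symm L N _ ih => exact ih.map Iso.symm
  | trans L M N _ _ ih₁ ih₂ => exact ⟨ih₁.some ≪≫ ih₂.some⟩
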